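/- **Theorem (Endogeny and bivariate uniqueness).** Let $S$ and $\Omega$ be Polish spaces with their Borel $\sigma$-fields, let $r$ be a probability law on $\Omega$, and write $\mathcal P(S)$ for the space of probability laws on $S$. For $k\in\overline{\mathbb N}:=\{0,1,\dots\}\cup\{\infty\}$ let $S^k$ be the space of sequences of length $k$ in $S$ with the product topology. Let $\kappa:\Omega\to\overline{\mathbb N}$ be measurable, and for every $\omega\in\Omega$ let $\gamma[\omega]:S^{\kappa(\omega)}\to S$ be a map such that, for each $k\in\overline{\mathbb N}$, $(\omega,x)\mapsto\gamma[\omega](x)$ is jointly measurable on $\{\kappa=k\}\times S^k$. Let $T:\mathcal P(S)\to\mathcal P(S)$ be the map for which $T(\mu)$ is the law of $\gamma[\omega](X_1,\dots,X_{\kappa(\omega)})$, where $\omega$ has law $r$ and $X_1,X_2,\dots$ are i.i.d. with law $\mu$, independent of $\omega$. For $n\in\{1,2,\dots\}\cup\{\infty\}$ let $\gamma^{(n)}[\omega]:(S^n)^{\kappa(\omega)}\to S^n$ be the map that applies $\gamma[\omega]$ to each of the $n$ coordinates, i.e. $\gamma^{(n)}[\omega](x)=\big(\gamma[\omega]((x_i^j)_i)\big)_{j}$,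 and let $T^{(n)}:\mathcal P(S^n)\to\mathcal P(S^n)$ be defined from $\gamma^{(n)}$ and $r$ as $T$ is from $\gamma$ and $r$. For $\mu\in\mathcal P(S)$ let $\mathcal P(S^n)_\mu$ be the set of laws on $S^n$ whose one-dimensional marginals are all equal to $\mu$, let $\mathcal P_{\rm sym}(S^n)_\mu$ be the set of those that are moreover invariant under permutations of the $n$ coordinates, and let $\overline\mu^{(n)}$ be the law of $(X,\dots,X)\in S^n$ where $X$ has law $\mu$. Let $d\in\{1,2,\dots\}\cup\{\infty\}$ satisfy $\kappa(\omega)\le d$ for all $\omega$, and let $\mathbb T$ be the set of finite words over $\{1,\dots,d\}$ (over $\{1,2,\dots\}$ if $d=\infty$), where $|\mathbf i|$ is the length of the word $\mathbf i$ and $\varnothing$ is the empty word. If $T(\mu)=\mu$, the recursive tree process (RTP) corresponding to $\mu$ is the collection $(\omega_{\mathbf i},X_{\mathbf i})_{\mathbf i\in\mathbb T}$ of $\Omega\times S$-valued random variables, unique in law, such that the $(\omega_{\mathbf i})_{\mathbf i\in\mathbb T}$ are i.i.d. with law $r$; for each $t\ge1$ the $(X_{\mathbf i})_{|\mathbf i|=t}$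 are i.i.d. with law $\mu$ and independent of $(\omega_{\mathbf i})_{|\mathbf i|<t}$; and $X_{\mathbf i}=\gamma[\omega_{\mathbf i}](X_{\mathbf i1},\dots,X_{\mathbf i\kappa(\omega_{\mathbf i})})$ a.s. for all $\mathbf i\in\mathbb T$. It is called endogenous if $X_\varnothing$ is a.s. equal to a random variable that is measurable with respect to the $\sigma$-field generated by $(\omega_{\mathbf i})_{\mathbf i\in\mathbb T}$. Let $\mu\in\mathcal P(S)$ satisfy $T(\mu)=\mu$. Then the following statements are equivalent. (i) The RTP corresponding to $\mu$ is endogenous. (ii) The measure $\overline\mu^{(2)}$ is the unique fixed point of $T^{(2)}$ in $\mathcal P_{\rm sym}(S^2)_\mu$. (iii) For all $n\in\{1,2,\dots\}\cup\{\infty\}$ and all $\nu\in\mathcal P(S^n)_\mu$, $(T^{(n)})^t(\nu)$ converges weakly to $\overline\mu^{(n)}$ as $t\to\infty$. No continuity of $\gamma[\omega]$, $T$ or $T^{(n)}$ is assumed. -/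

import Mathlib

open MeasureTheory ProbabilityTheory Filter Topology

universe u v w

/-- The index set `{0, 1, …, k - 1}` for `k` finite, and all of `ℕ` for `k = ∞`.
The space `S^k` (`0 ≤ k ≤ ∞`) is `Idx k → S`, with the product topology and σ-field. -/
abbrev Idx (k : ℕ∞) : Type := {i : ℕ // (i : ℕ∞) < k}

/-- A random map: a measurable `κ : Ω → {0, 1, …, ∞}` and a map
`γ[ω] : S^{κ(ω)} → S` for every `ω`, such that for every `k` the function
`(ω, x) ↦ γ[ω](x)` is jointly measurable on `{κ = k} × S^k`. -/
structure RandomMap (Ω : Type v) (S : Type u) [MeasurableSpace Ω] [MeasurableSpace S] where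
  κ : Ω → ℕ∞
  γ : (ω : Ω) → (Idx (κ ω) → S) → S
  measurable_κ : Measurable κ
  measurable_γ : ∀ k : ℕ∞, Measurable
    (fun p : {ω : Ω // κ ω = k} × (Idx k → S) =>
      γ p.1.1 (fun i => p.2 ⟨i.1, i.2.trans_eq p.1.2⟩))

/-- The vertices of the tree `𝕋^d`: finite words over the alphabet `Idx d`.
The length of a word is its `List.length`. -/
abbrev TreeWord (d : ℕ∞) : Type := List (Idx d)

namespace RandomMap

variable {Ω : Type v} {S : Type u} [MeasurableSpace Ω] [MeasurableSpace S]

/-- Each single map `γ[ω]` is measurable. -/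
lemma measurable_γ_apply (G : RandomMap Ω S) (ω : Ω) : Measurable (G.γ ω) :=
  (G.measurable_γ (G.κ ω)).comp
    (measurable_prodMk_left (x := (⟨ω, rfl⟩ : {ω' : Ω // G.κ ω' = G.κ ω})))

/-- For a measurable map `g = γ[ω] : S^k → S`, the law `T_g(μ)` of `g(X_1, …, X_k)` where
`X_1, …, X_k` are i.i.d. with law `μ`. -/
noncomputable def singleLaw (G : RandomMap Ω S) (μ : ProbabilityMeasure S) (ω : Ω) : Measure S :=
  (Measure.infinitePi (fun _ : Idx (G.κ ω) => (μ : Measure S))).map (G.γ ω)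

lemma measurable_singleLaw (G : RandomMap Ω S) (μ : ProbabilityMeasure S) :
    Measurable (G.singleLaw μ) := by
  refine Measure.measurable_of_measurable_coe _ fun s hs => ?_
  have key : ∀ k : ℕ∞, Measurable (fun ω : {ω : Ω // G.κ ω = k} => G.singleLaw μ ω.1 s) := by
    intro k
    have h := measurable_measure_prodMk_left
      (ν := Measure.infinitePi (fun _ : Idx k => (μ : Measure S))) (G.measurable_γ k hs)
    convert h using 2 with ω
    obtain ⟨ω, rfl⟩ := ω
    rw [singleLaw, Measure.map_apply (G.measurable_γ_apply ω) hs]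
    rfl
  intro B hB
  have : (fun ω => G.singleLaw μ ω s) ⁻¹' B
      = ⋃ k : ℕ∞, Subtype.val ''
        ((fun ω : {ω : Ω // G.κ ω = k} => G.singleLaw μ ω.1 s) ⁻¹' B) := by
    ext ω
    simp
  rw [this]
  refine MeasurableSet.iUnion fun k => ?_
  exact MeasurableSet.subtype_image (G.measurable_κ (measurableSet_singleton k)) (key k hB)

/-- The map `T : P(S) → P(S)`, `T(μ) = ∫ r(dω) T_{γ[ω]}(μ)`, where the external randomness
`ω` has law `r`. -/
noncomputable def T (G : RandomMap Ω S) (r : ProbabilityMeasure Ω) (μ : ProbabilityMeasure S) :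
    ProbabilityMeasure S :=
  ⟨(r : Measure Ω).bind (G.singleLaw μ),
    isProbabilityMeasure_bind (G.measurable_singleLaw μ).aemeasurable
      (Eventually.of_forall fun ω =>
        Measure.isProbabilityMeasure_map (G.measurable_γ_apply ω).aemeasurable)⟩

/-- The `n`-variate map `γ^{(n)}[ω] : (S^n)^{κ(ω)} → S^n`, which applies the same map `γ[ω]` to
each of the `n` rows. The index `n` may be infinite. -/
def nvariate (G : RandomMap Ω S) (n : ℕ∞) : RandomMap Ω (Idx n → S) where
  κ := G.κ
  γ ω x := fun j => G.γ ω (fun i => x i j)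
  measurable_κ := G.measurable_κ
  measurable_γ k := by
    refine measurable_pi_lambda _ fun j => ?_
    have h : Measurable (fun p : {ω : Ω // G.κ ω = k} × (Idx k → Idx n → S) =>
        (p.1, fun i => p.2 i j)) := by fun_prop
    exact (G.measurable_γ k).comp h

/-- The `n`-variate map `T^{(n)} : P(S^n) → P(S^n)`. -/
noncomputable def Tn (G : RandomMap Ω S) (r : ProbabilityMeasure Ω) (n : ℕ∞) :
    ProbabilityMeasure (Idx n → S) → ProbabilityMeasure (Idx n → S) :=
  (G.nvariate n).T r

/-- `(ω_𝐢, X_𝐢)_{𝐢 ∈ 𝕋^d}`, defined on the probability space `(A, P)`, is a Recursive Tree Process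
corresponding to `γ`, `r` and the solution `μ` of the RDE `T(μ) = μ`. -/
structure IsRTP (G : RandomMap Ω S) (r : ProbabilityMeasure Ω) {d : ℕ∞} (hd : ∀ ω, G.κ ω ≤ d)
    (μ : ProbabilityMeasure S) {A : Type w} [MeasurableSpace A] (P : Measure A)
    (W : TreeWord d → A → Ω) (X : TreeWord d → A → S) : Prop where
  measurable_W : ∀ i, Measurable (W i)
  measurable_X : ∀ i, Measurable (X i)
  /-- The `ω_𝐢` are i.i.d. with common law `r`. -/
  iIndepFun_W : iIndepFun W P
  law_W : ∀ i, P.map (W i) = r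
  /-- For each `t ≥ 1`, the `X_𝐢` with `|𝐢| = t` are i.i.d. with common law `μ` ... -/
  iIndepFun_X : ∀ t : ℕ, 1 ≤ t →
    iIndepFun (fun i : {i : TreeWord d // i.length = t} => X i.1) P
  law_X : ∀ t : ℕ, 1 ≤ t → ∀ i : TreeWord d, i.length = t → P.map (X i) = μ
  /-- ... and independent of the `ω_𝐢` with `|𝐢| < t`. -/
  indepFun_X_W : ∀ t : ℕ, 1 ≤ t →
    IndepFun (fun a (i : {i : TreeWord d // i.length = t}) => X i.1 a)
      (fun a (i : {i : TreeWord d // i.length < t}) => W i.1 a) P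
  /-- `X_𝐢 = γ[ω_𝐢](X_{𝐢1}, …, X_{𝐢κ(ω_𝐢)})` almost surely, for all `𝐢`. -/
  recursion : ∀ i : TreeWord d, ∀ᵐ a ∂P,
    X i a = G.γ (W i a) (fun j => X (i ++ [⟨j.1, j.2.trans_le (hd (W i a))⟩]) a)

/-- `X_∅` is almost surely equal to a random variable that is measurable w.r.t. the σ-field
generated by `(ω_𝐢)_{𝐢 ∈ 𝕋}`. -/
def RootMeasurable {d : ℕ∞} {A : Type w} [MeasurableSpace A] (P : Measure A)
    (W : TreeWord d → A → Ω) (X : TreeWord d → A → S) : Prop :=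
  ∃ Y : A → S,
    Measurable[⨆ i, MeasurableSpace.comap (W i) inferInstance] Y ∧ X [] =ᵐ[P] Y

/-- The RTP corresponding to `μ` is endogenous. The RTP is determined through its joint law, so
it is realized by the coordinate maps on the path space `(Ω × S)^𝕋`: an RTP for `μ` exists, and
`X_∅` is a.s. measurable w.r.t. the σ-field generated by `(ω_𝐢)_{𝐢 ∈ 𝕋}`. -/
def Endogenous (G : RandomMap Ω S) (r : ProbabilityMeasure Ω) {d : ℕ∞} (hd : ∀ ω, G.κ ω ≤ d)
    (μ : ProbabilityMeasure S) : Prop :=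
  (∃ P : ProbabilityMeasure (TreeWord d → Ω × S),
    G.IsRTP r hd μ (P : Measure (TreeWord d → Ω × S)) (fun i z => (z i).1) (fun i z => (z i).2)) ∧
  ∀ P : ProbabilityMeasure (TreeWord d → Ω × S),
    G.IsRTP r hd μ (P : Measure (TreeWord d → Ω × S)) (fun i z => (z i).1) (fun i z => (z i).2) →
      RootMeasurable (P : Measure (TreeWord d → Ω × S)) (fun i z => (z i).1) (fun i z => (z i).2)

end RandomMap

/-- `P(S^n)_μ`: the laws on `S^n` all of whose one-dimensional marginals are `μ`. -/
def lawsWithMarginal {S : Type u} [MeasurableSpace S] (n : ℕ∞) (μ : ProbabilityMeasure S) :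
    Set (ProbabilityMeasure (Idx n → S)) :=
  {ν | ∀ m : Idx n, (ν : Measure (Idx n → S)).map (fun x => x m) = μ}

/-- `P_sym(S^n)_μ`: the laws in `P(S^n)_μ` that are symmetric w.r.t. permutations of the
coordinates. -/
def symLawsWithMarginal {S : Type u} [MeasurableSpace S] (n : ℕ∞) (μ : ProbabilityMeasure S) :
    Set (ProbabilityMeasure (Idx n → S)) :=
  {ν | ν ∈ lawsWithMarginal n μ ∧
    ∀ σ : Equiv.Perm (Idx n), (ν : Measure (Idx n → S)).map (fun x => x ∘ σ) = ν}

/-- The diagonal law `μ̄^{(n)}`: the law of `(X, …, X)` where `X` has law `μ`. -/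
noncomputable def diagLaw {S : Type u} [MeasurableSpace S] (n : ℕ∞) (μ : ProbabilityMeasure S) :
    ProbabilityMeasure (Idx n → S) :=
  μ.map (f := fun x (_ : Idx n) => x) (measurable_pi_lambda _ fun _ => measurable_id).aemeasurable

/-!
For a measurable set `A ⊆ S` let `p_t` be the conditional probability, given the randomness `ω_𝐢`
at depths `|𝐢| < t` in a tree whose values at depth `t` are i.i.d. with law `μ`, that the value at
the root lies in `A` (`RandomMap.rootProb`). All three statements express that `p_t` becomes
asymptotically `{0, 1}`-valued, that is `E[p_t ^ 2] → μ(A)`, for every `A`.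

Evaluating the tree shows that `(T^{(n)})^t(ν)` is the law at the root when i.i.d. elements of `S^n`
with law `ν` are placed at depth `t` (`RandomMap.iterate_T_eq_map`). For `ν = μ ⊗ μ` it gives mass
`E[p_t ^ 2]` to `A × A` (`RandomMap.iterate_T2_indepPair`), and for any `ν` with marginals `μ` the
probability that one coordinate lies in `A` and another one does not is at most
`2 E[p_t (1 - p_t)]` (`RandomMap.iterate_Tn_separate_le`).

In a recursive tree process, `p_t` is the martingale `P(X_∅ ∈ A | ω_𝐢, |𝐢| < t)`. It converges to
the conditional probability given all `ω_𝐢`, which for an endogenous process is the indicator of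
`X_∅ ∈ A`. Hence no set `A` separates two coordinates under `(T^{(n)})^t(ν)` in the limit, and this
forces weak convergence to the diagonal law (`tendsto_diagLaw`). Bivariate uniqueness follows
by applying this convergence to fixed points.

Conversely, let `ν` be the law of two copies of `X_∅` that are conditionally independent given all
`ω_𝐢`. Then `(T^{(2)})^t(μ ⊗ μ)` converges to `ν` on rectangles
(`RandomMap.IsRTP.tendsto_iterate_T2`). Without continuity of `γ`, the map `T^{(2)}` still preserves
this kind of convergence, because the marginals are fixed (`RandomMap.tendsto_T2_rect`); so `ν` is a
symmetric fixed point. If it is the diagonal law, then the conditional law of `X_∅` is a point mass,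
and `X_∅` is a function of the `ω_𝐢` (`RandomMap.IsRTP.rootMeasurable`).

Endogeny includes the existence of a recursive tree process, which is constructed from the root
downwards with the help of independent uniform variables (`RandomMap.exists_isRTP`).
-/

/-! ### Infinite product measures -/

/-- Pairs of independent families of i.i.d. random variables are i.i.d. -/
lemma infinitePi_map_zip {ι E F : Type*} [MeasurableSpace E] [MeasurableSpace F]
    (ρ : Measure E) [IsProbabilityMeasure ρ] (σ : Measure F) [IsProbabilityMeasure σ] :
    ((Measure.infinitePi (fun _ : ι => ρ)).prod (Measure.infinitePi (fun _ : ι => σ))).map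
        (fun p i => (p.1 i, p.2 i)) = Measure.infinitePi (fun _ : ι => ρ.prod σ) := by
  refine Measure.eq_infinitePi _ fun s t ht => ?_
  have hm : MeasurableSet ((s : Set ι).pi t) :=
    MeasurableSet.pi s.countable_toSet fun i _ => ht i
  rw [Measure.map_apply (by fun_prop) hm]
  have h1 := (measurePreserving_arrowProdEquivProdArrow E F s (fun _ => ρ) (fun _ => σ)).map_eq
  have h2 : (Measure.infinitePi (fun _ : ι => ρ)).prod (Measure.infinitePi (fun _ : ι => σ))
      ((fun p i => (p.1 i, p.2 i)) ⁻¹' ((s : Set ι).pi t))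
    = (Measure.pi (fun _ : s => ρ)).prod (Measure.pi (fun _ : s => σ))
      ((fun p (i : s) => (p.1 i, p.2 i)) ⁻¹' (Set.univ.pi fun i : s => t i)) := by
    rw [← Measure.infinitePi_map_restrict (fun _ : ι => ρ) (I := s),
      ← Measure.infinitePi_map_restrict (fun _ : ι => σ) (I := s),
      Measure.map_prod_map _ _ (by fun_prop) (by fun_prop),
      Measure.map_apply (by fun_prop)
        ((show Measurable (fun (p : (s → E) × (s → F)) (i : s) => (p.1 i, p.2 i)) by fun_prop)
          (MeasurableSet.univ_pi fun i => ht i))]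
    congr 1
    ext p
    simp [Set.mem_pi]
  rw [h2, ← h1, Measure.map_apply (MeasurableEquiv.measurable _)
        ((show Measurable (fun (p : (s → E) × (s → F)) (i : s) => (p.1 i, p.2 i)) by fun_prop)
          (MeasurableSet.univ_pi fun i => ht i)),
      ← Finset.prod_coe_sort s (fun i => (ρ.prod σ) (t i)),
          ← Measure.pi_pi]
  rfl

lemma infinitePi_map_unzip {ι E F : Type*} [MeasurableSpace E] [MeasurableSpace F]
    (ρ : Measure E) [IsProbabilityMeasure ρ] (σ : Measure F) [IsProbabilityMeasure σ] :
    (Measure.infinitePi (fun _ : ι => ρ.prod σ)).map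
        (fun z => ((fun i => (z i).1), (fun i => (z i).2)))
      = (Measure.infinitePi (fun _ : ι => ρ)).prod (Measure.infinitePi (fun _ : ι => σ)) := by
  rw [← infinitePi_map_zip, Measure.map_map (by fun_prop) (by fun_prop)]
  exact Measure.map_id

/-- Assembles a labelled tree from the label of its root and the subtrees of its children. -/
def glueTree {I E : Type*} (p : E × (I → List I → E)) : List I → E
  | [] => p.1
  | j :: w => p.2 j w

lemma measurable_glueTree {I E : Type*} [MeasurableSpace E] :
    Measurable (glueTree : E × (I → List I → E) → List I → E) := by
  refine measurable_pi_lambda _ fun w => ?_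
  cases w <;> simp only [glueTree] <;> fun_prop

/-- A tree with i.i.d. labels is a root label together with independent i.i.d. subtrees. -/
lemma map_glueTree {I E : Type*} [MeasurableSpace E] (ρ : Measure E) [IsProbabilityMeasure ρ] :
    (ρ.prod (Measure.infinitePi fun _ : I => Measure.infinitePi fun _ : List I => ρ)).map glueTree
      = Measure.infinitePi (fun _ : List I => ρ) := by
  classical
  refine Measure.eq_infinitePi _ fun s t ht => ?_
  have hm : MeasurableSet ((s : Set (List I)).pi t) :=
    MeasurableSet.pi s.countable_toSet fun i _ => ht i
  rw [Measure.map_apply measurable_glueTree hm]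
  -- the vertices other than the root, as pairs of a child of the root and a vertex of its subtree
  let e : I × List I ↪ List I := ⟨fun p => p.1 :: p.2, fun p q h => by
    simp only [List.cons.injEq] at h; exact Prod.ext h.1 h.2⟩
  let s' : Finset (I × List I) := s.preimage e e.injective.injOn
  have h1 : (glueTree ⁻¹' ((s : Set (List I)).pi t) : Set (E × (I → List I → E)))
      = (if [] ∈ s then t [] else Set.univ) ×ˢ
        ((fun y (p : I × List I) => y p.1 p.2) ⁻¹'
          ((s' : Set (I × List I)).pi fun p => t (e p))) := by
    ext ⟨a, y⟩
    simp only [Set.mem_preimage, Set.mem_pi, Set.mem_prod, Finset.mem_coe, s', Finset.mem_preimage]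
    constructor
    · intro h
      refine ⟨?_, fun p hp => h _ hp⟩
      split_ifs with h0
      · exact h _ h0
      · trivial
    · rintro ⟨h0, h⟩ w hw
      match w with
      | [] => simpa [hw, glueTree] using h0
      | j :: w => exact h (j, w) hw
  have h2 := Measure.infinitePi_map_curry_symm (fun (_ : I) (_ : List I) => ρ)
  have h3 : (Measure.infinitePi fun _ : I => Measure.infinitePi fun _ : List I => ρ)
      ((fun y (p : I × List I) => y p.1 p.2) ⁻¹' ((s' : Set (I × List I)).pi fun p => t (e p)))
      = ∏ p ∈ s', ρ (t (e p)) := by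
    rw [← Measure.infinitePi_pi (fun _ : I × List I => ρ) (fun p _ => ht (e p)), ← h2,
      Measure.map_apply (MeasurableEquiv.measurable _)
        (MeasurableSet.pi s'.countable_toSet fun i _ => ht _)]
    rfl
  rw [h1, Measure.prod_prod, h3]
  have h4 : s.erase [] = s'.map e := by
    ext w
    match w with
    | [] => simp [e]
    | j :: w =>
      simp only [Finset.mem_erase, Finset.mem_map, s', Finset.mem_preimage]
      constructor
      · rintro ⟨-, h⟩; exact ⟨(j, w), h, rfl⟩
      · rintro ⟨p, h, hp⟩; exact ⟨by simp, hp ▸ h⟩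
  have h5 : ∏ p ∈ s', ρ (t (e p)) = ∏ w ∈ s.erase [], ρ (t w) := by rw [h4, Finset.prod_map]
  rw [h5]
  split_ifs with h0
  · exact Finset.mul_prod_erase s (fun w => ρ (t w)) h0
  · rw [measure_univ, one_mul, Finset.erase_eq_of_notMem h0]

lemma map_rootSplit {I E : Type*} [MeasurableSpace E] (ρ : Measure E) [IsProbabilityMeasure ρ] :
    (Measure.infinitePi (fun _ : List I => ρ)).map (fun z => (z [], fun j w => z (j :: w)))
      = ρ.prod (Measure.infinitePi fun _ : I => Measure.infinitePi fun _ : List I => ρ) := by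
  rw [← map_glueTree ρ, Measure.map_map (by fun_prop) measurable_glueTree, map_glueTree]
  exact Measure.map_id

/-- The root decomposition of a pair of independent trees, each with i.i.d. labels. -/
lemma map_rootSplit_prod {I E F : Type*} [MeasurableSpace E] [MeasurableSpace F]
    (ρ : Measure E) [IsProbabilityMeasure ρ] (σ : Measure F) [IsProbabilityMeasure σ] :
    ((Measure.infinitePi (fun _ : List I => ρ)).prod (Measure.infinitePi (fun _ : List I => σ))).map
        (fun p => (p.1 [], fun j => ((fun w => p.1 (j :: w)), (fun w => p.2 (j :: w)))))
      = ρ.prod (Measure.infinitePi fun _ : I =>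
          (Measure.infinitePi (fun _ : List I => ρ)).prod
            (Measure.infinitePi (fun _ : List I => σ))) := by
  have h1 : ρ = (ρ.prod σ).map Prod.fst := by simp
  have : (Measure.infinitePi fun _ : I =>
          (Measure.infinitePi (fun _ : List I => ρ)).prod
            (Measure.infinitePi (fun _ : List I => σ)))
      = (Measure.infinitePi fun _ : I => Measure.infinitePi fun _ : List I => ρ.prod σ).map
        (fun y j => ((fun w => (y j w).1), (fun w => (y j w).2))) := by
    rw [Measure.infinitePi_map_pi (fun _ : I => Measure.infinitePi fun _ : List I => ρ.prod σ)
      (f := fun _ z => ((fun w => (z w).1), (fun w => (z w).2))) (fun _ => by fun_prop)]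
    simp_rw [infinitePi_map_unzip]
  rw [this]
  conv_rhs => enter [1]; rw [h1]
  rw [Measure.map_prod_map _ _ (by fun_prop) (by fun_prop), ← map_rootSplit,
    ← infinitePi_map_unzip, Measure.map_map (by fun_prop) (by fun_prop),
    Measure.map_map (by fun_prop) (by fun_prop)]
  rfl

/-! ### The map `T` with a fixed number of arguments -/

namespace RandomMap

variable {Ω : Type v} {S : Type u} [MeasurableSpace Ω] [MeasurableSpace S]

/-- The maps `γ[ω]`, regarded as functions of `d` arguments of which only the first `κ(ω)` are
used, and combined into a single function of `ω` and the arguments. -/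
def fullγ (G : RandomMap Ω S) {d : ℕ∞} (hd : ∀ ω, G.κ ω ≤ d) (p : Ω × (Idx d → S)) : S :=
  G.γ p.1 (fun i => p.2 ⟨i.1, i.2.trans_le (hd p.1)⟩)

lemma measurable_fullγ (G : RandomMap Ω S) {d : ℕ∞} (hd : ∀ ω, G.κ ω ≤ d) :
    Measurable (G.fullγ hd) := by
  have key : ∀ k : ℕ∞, Measurable (fun p : {p : Ω × (Idx d → S) // G.κ p.1 = k} =>
      G.fullγ hd p.1) := by
    intro k
    by_cases hk : k ≤ d
    · have h : Measurable (fun p : {p : Ω × (Idx d → S) // G.κ p.1 = k} =>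
          ((⟨p.1.1, p.2⟩, fun i => p.1.2 ⟨i.1, i.2.trans_le hk⟩) :
            {ω : Ω // G.κ ω = k} × (Idx k → S))) := by
        refine Measurable.prodMk (Measurable.subtype_mk (by fun_prop)) ?_
        fun_prop
      exact (G.measurable_γ k).comp h
    · have : IsEmpty {p : Ω × (Idx d → S) // G.κ p.1 = k} := ⟨fun p => hk (p.2 ▸ hd p.1.1)⟩
      exact measurable_of_empty _
  intro B hB
  have : G.fullγ hd ⁻¹' B = ⋃ k : ℕ∞, Subtype.val ''
      ((fun p : {p : Ω × (Idx d → S) // G.κ p.1 = k} => G.fullγ hd p.1) ⁻¹' B) := by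
    ext p
    simp
  rw [this]
  exact MeasurableSet.iUnion fun k => MeasurableSet.subtype_image
    ((G.measurable_κ.comp measurable_fst) (measurableSet_singleton k)) (key k hB)

lemma T_eq_map (G : RandomMap Ω S) (r : ProbabilityMeasure Ω) {d : ℕ∞} (hd : ∀ ω, G.κ ω ≤ d)
    (ν : ProbabilityMeasure S) :
    (G.T r ν : Measure S) = ((r : Measure Ω).prod
      (Measure.infinitePi fun _ : Idx d => (ν : Measure S))).map (G.fullγ hd) := by
  ext s hs
  change ((r : Measure Ω).bind (G.singleLaw ν)) s = _
  rw [Measure.bind_apply hs (G.measurable_singleLaw ν).aemeasurable,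
    Measure.map_apply (G.measurable_fullγ hd) hs,
    Measure.prod_apply (G.measurable_fullγ hd hs)]
  refine lintegral_congr fun ω => ?_
  have hinj : Function.Injective
      (fun i : Idx (G.κ ω) => (⟨i.1, i.2.trans_le (hd ω)⟩ : Idx d)) := by
    intro i j h
    exact Subtype.ext (congrArg (fun k : Idx d => k.1) h)
  rw [singleLaw, Measure.map_apply (G.measurable_γ_apply ω) hs,
    ← Measure.map_infinitePi_infinitePi_of_inj
      (P := fun _ : Idx d => (ν : Measure S)) hinj,
    Measure.map_apply (by fun_prop) (G.measurable_γ_apply ω hs)]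
  rfl

lemma fullγ_nvariate (G : RandomMap Ω S) {d : ℕ∞} (hd : ∀ ω, G.κ ω ≤ d) (n : ℕ∞)
    (p : Ω × (Idx d → Idx n → S)) (j : Idx n) :
    (G.nvariate n).fullγ (d := d) hd p j = G.fullγ hd (p.1, fun i => p.2 i j) := rfl

/-- A coordinate of a law transformed by `T^{(n)}` is transformed by `T`. -/
lemma map_Tn (G : RandomMap Ω S) (r : ProbabilityMeasure Ω) {n : ℕ∞} (j : Idx n)
    (ν : ProbabilityMeasure (Idx n → S)) (μ : ProbabilityMeasure S)
    (h : (ν : Measure (Idx n → S)).map (fun y => y j) = μ) :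
    (G.Tn r n ν : Measure (Idx n → S)).map (fun y => y j) = G.T r μ := by
  have hd : ∀ ω, G.κ ω ≤ ⊤ := fun _ => le_top
  have hd' : ∀ ω, (G.nvariate n).κ ω ≤ ⊤ := fun _ => le_top
  rw [Tn, (G.nvariate n).T_eq_map r hd', G.T_eq_map r hd, ← h,
    ← Measure.infinitePi_map_pi (fun _ : Idx ⊤ => (ν : Measure (Idx n → S)))
      (f := fun _ y => y j) (fun _ => by fun_prop),
    Measure.map_map (by fun_prop) ((G.nvariate n).measurable_fullγ hd')]
  conv_rhs => enter [2, 1]; rw [← Measure.map_id (μ := (r : Measure Ω))]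
  rw [Measure.map_prod_map _ _ measurable_id (by fun_prop),
    Measure.map_map (G.measurable_fullγ hd) (by fun_prop)]
  rfl

lemma iterate_Tn_mem (G : RandomMap Ω S) (r : ProbabilityMeasure Ω) {n : ℕ∞}
    {μ : ProbabilityMeasure S} (hμ : G.T r μ = μ) {ν : ProbabilityMeasure (Idx n → S)}
    (hν : ν ∈ lawsWithMarginal n μ) (t : ℕ) : (G.Tn r n)^[t] ν ∈ lawsWithMarginal n μ := by
  induction t with
  | zero => exact hν
  | succ t ih =>
    intro j
    rw [Function.iterate_succ_apply', G.map_Tn r j _ μ (ih j), hμ]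

lemma Tn_diagLaw (G : RandomMap Ω S) (r : ProbabilityMeasure Ω) (n : ℕ∞)
    (μ : ProbabilityMeasure S) : G.Tn r n (diagLaw n μ) = diagLaw n (G.T r μ) := by
  have hd : ∀ ω, G.κ ω ≤ ⊤ := fun _ => le_top
  have hd' : ∀ ω, (G.nvariate n).κ ω ≤ ⊤ := fun _ => le_top
  apply Subtype.ext
  change (G.Tn r n (diagLaw n μ) : Measure (Idx n → S))
    = (G.T r μ : Measure S).map (fun x _ => x)
  rw [Tn, (G.nvariate n).T_eq_map r hd', G.T_eq_map r hd]
  have : (diagLaw n μ : Measure (Idx n → S)) = (μ : Measure S).map (fun x _ => x) := rfl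
  rw [this, ← Measure.infinitePi_map_pi (fun _ : Idx ⊤ => (μ : Measure S))
      (f := fun _ x _ => x) (fun _ => by fun_prop),
    Measure.map_map (by fun_prop) (G.measurable_fullγ hd)]
  conv_lhs => enter [2, 1]; rw [← Measure.map_id (μ := (r : Measure Ω))]
  rw [Measure.map_prod_map _ _ measurable_id (by fun_prop),
    Measure.map_map ((G.nvariate n).measurable_fullγ hd') (by fun_prop)]
  rfl

end RandomMap

/-! ### Evaluation of finite trees -/

/-- The value at the root of a tree of depth `t` when a map `g` is evaluated at every vertex `w`
with `|w| < t`, using the randomness `θ w` and the values at the children, and starting from the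
values `x w` at the vertices with `|w| = t`. Other values of `θ` and `x` are ignored. -/
def treeEval {Ω S I : Type*} (g : Ω × (I → S) → S) : ℕ → (List I → Ω) → (List I → S) → S
  | 0, _, x => x []
  | t + 1, θ, x => g (θ [], fun j => treeEval g t (fun w => θ (j :: w)) (fun w => x (j :: w)))

section treeEval

variable {Ω S I : Type*} [MeasurableSpace Ω] [MeasurableSpace S] {g : Ω × (I → S) → S}

omit [MeasurableSpace Ω] [MeasurableSpace S] in
lemma treeEval_congr (g : Ω × (I → S) → S) (t : ℕ) {θ θ' : List I → Ω} {x x' : List I → S}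
    (hθ : ∀ w, w.length < t → θ w = θ' w) (hx : ∀ w, w.length = t → x w = x' w) :
    treeEval g t θ x = treeEval g t θ' x' := by
  induction t generalizing θ θ' x x' with
  | zero => exact hx [] rfl
  | succ t ih =>
    simp only [treeEval]
    rw [hθ [] (by simp)]
    congr 2
    ext j
    exact ih (fun w hw => hθ _ (by simpa using hw)) (fun w hw => hx _ (by simpa using hw))

lemma measurable_treeEval (hg : Measurable g) (t : ℕ) :
    Measurable (fun p : (List I → Ω) × (List I → S) => treeEval g t p.1 p.2) := by
  induction t with
  | zero => simp only [treeEval]; fun_prop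
  | succ t ih =>
    simp only [treeEval]
    refine hg.comp (Measurable.prodMk (by fun_prop) (measurable_pi_lambda _ fun j => ?_))
    exact ih.comp (f := fun p : (List I → Ω) × (List I → S) =>
      ((fun w => p.1 (j :: w)), (fun w => p.2 (j :: w)))) (by fun_prop)

end treeEval

namespace RandomMap

variable {Ω : Type v} {S : Type u} [MeasurableSpace Ω] [MeasurableSpace S]

lemma treeEval_nvariate (G : RandomMap Ω S) {d : ℕ∞} (hd : ∀ ω, G.κ ω ≤ d) (n : ℕ∞) (t : ℕ)
    (θ : TreeWord d → Ω) (x : TreeWord d → Idx n → S) (j : Idx n) :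
    treeEval ((G.nvariate n).fullγ (d := d) hd) t θ x j
      = treeEval (G.fullγ hd) t θ (fun w => x w j) := by
  induction t generalizing θ x with
  | zero => rfl
  | succ t ih =>
    simp only [treeEval, fullγ_nvariate, ih]

/-- `T^t(ν)` is the law at the root of a tree of depth `t` whose leaves are i.i.d. with law `ν`. -/
lemma iterate_T_eq_map (G : RandomMap Ω S) (r : ProbabilityMeasure Ω) {d : ℕ∞}
    (hd : ∀ ω, G.κ ω ≤ d) (ν : ProbabilityMeasure S) (t : ℕ) :
    (((G.T r)^[t] ν : ProbabilityMeasure S) : Measure S) =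
      ((Measure.infinitePi fun _ : TreeWord d => (r : Measure Ω)).prod
        (Measure.infinitePi fun _ : TreeWord d => (ν : Measure S))).map
          (fun p => treeEval (G.fullγ hd) t p.1 p.2) := by
  induction t with
  | zero =>
    simp only [treeEval, Function.iterate_zero, id]
    have h1 := Measure.infinitePi_map_eval (fun _ : TreeWord d => (ν : Measure S)) []
    conv_lhs => rw [← h1, ← Measure.snd_prod
      (μ := Measure.infinitePi fun _ : TreeWord d => (r : Measure Ω))
      (ν := Measure.infinitePi fun _ : TreeWord d => (ν : Measure S))]
    rw [Measure.snd, Measure.map_map (by fun_prop) (by fun_prop)]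
    rfl
  | succ t ih =>
    have hm := measurable_treeEval (G.measurable_fullγ hd) t
    rw [Function.iterate_succ_apply', G.T_eq_map r hd, ih,
      ← Measure.infinitePi_map_pi (fun _ : Idx d =>
          (Measure.infinitePi fun _ : TreeWord d => (r : Measure Ω)).prod
          (Measure.infinitePi fun _ : TreeWord d => (ν : Measure S))) (fun _ => hm)]
    conv_lhs => enter [2, 1]; rw [← Measure.map_id (μ := (r : Measure Ω))]
    rw [Measure.map_prod_map _ _ measurable_id (by fun_prop), ← map_rootSplit_prod,
      Measure.map_map (G.measurable_fullγ hd) (by fun_prop),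
      Measure.map_map ((G.measurable_fullγ hd).comp (by fun_prop)) (by fun_prop)]
    rfl

end RandomMap

/-! ### Conditional laws given the randomness in a finite tree -/

/-- The law on `S^2` of two independent random variables with law `μ`. -/
noncomputable def indepPair {S : Type u} [MeasurableSpace S] (μ : ProbabilityMeasure S) :
    ProbabilityMeasure (Idx 2 → S) :=
  ⟨Measure.infinitePi fun _ => (μ : Measure S), inferInstance⟩

/-- The first coordinate of `S^2`. -/
def fstIdx : Idx 2 := ⟨0, by norm_num⟩

/-- The second coordinate of `S^2`. -/
def sndIdx : Idx 2 := ⟨1, by norm_num⟩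

lemma idx_two_cases (i : Idx 2) : i = fstIdx ∨ i = sndIdx := by
  obtain ⟨i, hi⟩ := i
  have : i < 2 := by exact_mod_cast hi
  interval_cases i
  · exact Or.inl rfl
  · exact Or.inr rfl

lemma fstIdx_ne_sndIdx : fstIdx ≠ sndIdx := fun h => by
  have := congrArg (fun k : Idx 2 => k.1) h
  simp [fstIdx, sndIdx] at this

lemma measurableSet_rect {S : Type u} [MeasurableSpace S] {A B : Set S} (hA : MeasurableSet A)
    (hB : MeasurableSet B) : MeasurableSet {y : Idx 2 → S | y fstIdx ∈ A ∧ y sndIdx ∈ B} :=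
  (measurable_pi_apply fstIdx hA).inter (measurable_pi_apply sndIdx hB)

/-- One coordinate of an i.i.d. family of `S^n`-valued random variables is i.i.d. with the
marginal law. -/
lemma map_coord_infinitePi {S : Type u} [MeasurableSpace S] (μ : ProbabilityMeasure S)
    {ι : Type*} {n : ℕ∞} {ν : ProbabilityMeasure (Idx n → S)} (j : Idx n)
    (h : (ν : Measure (Idx n → S)).map (fun y => y j) = μ) :
    (Measure.infinitePi fun _ : ι => (ν : Measure (Idx n → S))).map (fun x w => x w j)
      = Measure.infinitePi fun _ : ι => (μ : Measure S) := by
  rw [Measure.infinitePi_map_pi (fun _ : ι => (ν : Measure (Idx n → S)))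
    (f := fun _ y => y j) (fun _ => by fun_prop)]
  simp_rw [h]

namespace RandomMap

variable {Ω : Type v} {S : Type u} [MeasurableSpace Ω] [MeasurableSpace S]

/-- The conditional probability, given the randomness `θ` in the tree, that the value at the root
lies in `A` if the values at depth `t` are i.i.d. with law `μ`. -/
noncomputable def rootProb (G : RandomMap Ω S) {d : ℕ∞} (hd : ∀ ω, G.κ ω ≤ d)
    (μ : ProbabilityMeasure S) (t : ℕ) (A : Set S) (θ : TreeWord d → Ω) : ℝ :=
  (Measure.infinitePi fun _ : TreeWord d => (μ : Measure S)).real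
    {x | treeEval (G.fullγ hd) t θ x ∈ A}

section

variable (G : RandomMap Ω S) (r : ProbabilityMeasure Ω) {d : ℕ∞} (hd : ∀ ω, G.κ ω ≤ d)
  (μ : ProbabilityMeasure S)

lemma measurable_treeEval_right (t : ℕ) (θ : TreeWord d → Ω) :
    Measurable (treeEval (G.fullγ hd) t θ) :=
  (measurable_treeEval (G.measurable_fullγ hd) t).comp (measurable_const.prodMk measurable_id)

lemma rootProb_nonneg (t : ℕ) (A : Set S) (θ : TreeWord d → Ω) : 0 ≤ G.rootProb hd μ t A θ :=
  measureReal_nonneg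

lemma rootProb_le_one (t : ℕ) (A : Set S) (θ : TreeWord d → Ω) : G.rootProb hd μ t A θ ≤ 1 :=
  measureReal_le_one

lemma measurable_rootProb (t : ℕ) {A : Set S} (hA : MeasurableSet A) :
    Measurable (G.rootProb hd μ t A) :=
  (measurable_measure_prodMk_left
    (measurable_treeEval (G.measurable_fullγ hd) t hA)).ennreal_toReal

lemma rootProb_compl (t : ℕ) {A : Set S} (hA : MeasurableSet A) (θ : TreeWord d → Ω) :
    G.rootProb hd μ t Aᶜ θ = 1 - G.rootProb hd μ t A θ :=
  probReal_compl_eq_one_sub (G.measurable_treeEval_right hd t θ hA)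

/-- Under `(T^{(n)})^t(ν)`, the probability of an event concerning two coordinates, conditioned
on the randomness in the tree. -/
lemma iterate_Tn_pair {n : ℕ∞} (ν : ProbabilityMeasure (Idx n → S)) (t : ℕ) (j k : Idx n)
    {A B : Set S} (hA : MeasurableSet A) (hB : MeasurableSet B) :
    (((G.Tn r n)^[t] ν : ProbabilityMeasure (Idx n → S)) : Measure (Idx n → S)).real
        {y | y j ∈ A ∧ y k ∈ B}
      = ∫ θ, (Measure.infinitePi fun _ : TreeWord d => (ν : Measure (Idx n → S))).real
          {x | treeEval (G.fullγ hd) t θ (fun w => x w j) ∈ A ∧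
            treeEval (G.fullγ hd) t θ (fun w => x w k) ∈ B}
        ∂(Measure.infinitePi fun _ : TreeWord d => (r : Measure Ω)) := by
  have hd' : ∀ ω, (G.nvariate n).κ ω ≤ d := hd
  have hm := measurable_treeEval ((G.nvariate n).measurable_fullγ hd') t
  have hset : MeasurableSet {y : Idx n → S | y j ∈ A ∧ y k ∈ B} :=
    (measurable_pi_apply j hA).inter (measurable_pi_apply k hB)
  rw [Tn, (G.nvariate n).iterate_T_eq_map r hd', measureReal_def, Measure.map_apply hm hset,
    Measure.prod_apply (hm hset), ← integral_toReal
      (measurable_measure_prodMk_left (hm hset)).aemeasurable (by simp)]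
  refine integral_congr_ae (Eventually.of_forall fun θ => ?_)
  simp only [measureReal_def]
  congr 2
  ext x
  simp only [Set.mem_preimage, Set.mem_ofPred_eq]
  rw [G.treeEval_nvariate hd, G.treeEval_nvariate hd]

lemma integrable_rootProb_mul (t : ℕ) {A B : Set S} (hA : MeasurableSet A) (hB : MeasurableSet B) :
    Integrable (fun θ => G.rootProb hd μ t A θ * G.rootProb hd μ t B θ)
      (Measure.infinitePi fun _ : TreeWord d => (r : Measure Ω)) := by
  refine Integrable.of_bound (C := 1)
    ((G.measurable_rootProb hd μ t hA).mul (G.measurable_rootProb hd μ t hB)).aestronglyMeasurable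
    (Eventually.of_forall fun θ => ?_)
  have h1 := G.rootProb_nonneg hd μ t A θ
  have h2 := G.rootProb_nonneg hd μ t B θ
  rw [Real.norm_of_nonneg (mul_nonneg h1 h2)]
  exact mul_le_one₀ (G.rootProb_le_one hd μ t A θ) h2 (G.rootProb_le_one hd μ t B θ)

lemma integrable_rootProb (t : ℕ) {A : Set S} (hA : MeasurableSet A) :
    Integrable (G.rootProb hd μ t A)
      (Measure.infinitePi fun _ : TreeWord d => (r : Measure Ω)) := by
  refine Integrable.of_bound (C := 1) (G.measurable_rootProb hd μ t hA).aestronglyMeasurable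
    (Eventually.of_forall fun θ => ?_)
  rw [Real.norm_of_nonneg (G.rootProb_nonneg hd μ t A θ)]
  exact G.rootProb_le_one hd μ t A θ

lemma iterate_T2_indepPair (t : ℕ) {A B : Set S} (hA : MeasurableSet A) (hB : MeasurableSet B) :
    (((G.Tn r 2)^[t] (indepPair μ) : ProbabilityMeasure (Idx 2 → S)) : Measure (Idx 2 → S)).real
        {y | y fstIdx ∈ A ∧ y sndIdx ∈ B}
      = ∫ θ, G.rootProb hd μ t A θ * G.rootProb hd μ t B θ
        ∂(Measure.infinitePi fun _ : TreeWord d => (r : Measure Ω)) := by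
  rw [G.iterate_Tn_pair r hd _ t fstIdx sndIdx hA hB]
  refine integral_congr_ae (Eventually.of_forall fun θ => ?_)
  have hswap : (Measure.infinitePi fun _ : TreeWord d =>
        (indepPair μ : Measure (Idx 2 → S))).map (fun x i w => x w i)
      = Measure.infinitePi fun _ : Idx 2 => Measure.infinitePi fun _ : TreeWord d =>
        (μ : Measure S) := by
    have h1 := Measure.infinitePi_map_curry_symm
      (fun (_ : TreeWord d) (_ : Idx 2) => (μ : Measure S))
    have h2 := Measure.infinitePi_map_curry (fun (_ : Idx 2) (_ : TreeWord d) => (μ : Measure S))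
    rw [← h2, ← Measure.map_infinitePi_infinitePi_of_inj
      (P := fun _ : TreeWord d × Idx 2 => (μ : Measure S))
      (Prod.swap_injective (α := Idx 2) (β := TreeWord d)), ← h1,
      Measure.map_map (by fun_prop) (by fun_prop), Measure.map_map (by fun_prop) (by fun_prop)]
    rfl
  let C : Idx 2 → Set (TreeWord d → S) := fun i =>
    treeEval (G.fullγ hd) t θ ⁻¹' (if i = fstIdx then A else B)
  have hC : ∀ i, MeasurableSet (C i) := fun i => by
    refine G.measurable_treeEval_right hd t θ ?_
    split_ifs <;> assumption
  have hset : {x : TreeWord d → Idx 2 → S | treeEval (G.fullγ hd) t θ (fun w => x w fstIdx) ∈ A ∧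
      treeEval (G.fullγ hd) t θ (fun w => x w sndIdx) ∈ B}
      = (fun x i w => x w i) ⁻¹'
        ((({fstIdx, sndIdx} : Finset (Idx 2)) : Set (Idx 2)).pi C) := by
    ext x
    simp [C, fstIdx_ne_sndIdx.symm]
  simp only [rootProb, measureReal_def]
  rw [hset, ← Measure.map_apply (by fun_prop)
    (MeasurableSet.pi (Finset.countable_toSet _) fun i _ => hC i), hswap,
    Measure.infinitePi_pi _ (fun i _ => hC i), Finset.prod_pair fstIdx_ne_sndIdx,
    ENNReal.toReal_mul]
  simp [C, fstIdx_ne_sndIdx.symm]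
  rfl

lemma integral_rootProb {μ : ProbabilityMeasure S} (hμ : G.T r μ = μ) (t : ℕ) {A : Set S}
    (hA : MeasurableSet A) :
    ∫ θ, G.rootProb hd μ t A θ ∂(Measure.infinitePi fun _ : TreeWord d => (r : Measure Ω))
      = (μ : Measure S).real A := by
  have hm := measurable_treeEval (G.measurable_fullγ hd) t
  have h := G.iterate_T_eq_map r hd μ t
  rw [Function.iterate_fixed hμ] at h
  conv_rhs => rw [h]
  rw [measureReal_def, Measure.map_apply hm hA, Measure.prod_apply (hm hA), ← integral_toReal
      (measurable_measure_prodMk_left (hm hA)).aemeasurable (by simp)]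
  rfl

/-- The probability that two coordinates are separated by `A` is controlled by the expected
conditional variance of the event that the root lies in `A`. The bound is uniform over all initial
laws with marginals `μ`. -/
lemma iterate_Tn_separate_le {μ : ProbabilityMeasure S} (hμ : G.T r μ = μ) {n : ℕ∞}
    {ν : ProbabilityMeasure (Idx n → S)} (hν : ν ∈ lawsWithMarginal n μ) (t : ℕ) (j k : Idx n)
    {A : Set S} (hA : MeasurableSet A) :
    (((G.Tn r n)^[t] ν : ProbabilityMeasure (Idx n → S)) : Measure (Idx n → S)).real
        {y | y j ∈ A ∧ y k ∈ Aᶜ}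
      ≤ 2 * ((μ : Measure S).real A - ∫ θ, G.rootProb hd μ t A θ * G.rootProb hd μ t A θ
        ∂(Measure.infinitePi fun _ : TreeWord d => (r : Measure Ω))) := by
  rw [G.iterate_Tn_pair r hd _ t j k hA hA.compl, ← G.integral_rootProb r hd hμ t hA,
    ← integral_sub (G.integrable_rootProb r hd μ t hA) (G.integrable_rootProb_mul r hd μ t hA hA),
    ← integral_const_mul]
  refine integral_mono_of_nonneg (Eventually.of_forall fun θ => measureReal_nonneg)
    (((G.integrable_rootProb r hd μ t hA).sub
      (G.integrable_rootProb_mul r hd μ t hA hA)).const_mul 2)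
    (Eventually.of_forall fun θ => ?_)
  have hcoord : ∀ (i : Idx n) {B : Set S}, MeasurableSet B →
      (Measure.infinitePi fun _ : TreeWord d => (ν : Measure (Idx n → S))).real
        {x | treeEval (G.fullγ hd) t θ (fun w => x w i) ∈ B} = G.rootProb hd μ t B θ := by
    intro i B hB
    have hB' : MeasurableSet {x | treeEval (G.fullγ hd) t θ x ∈ B} :=
      G.measurable_treeEval_right hd t θ hB
    rw [rootProb, ← map_coord_infinitePi μ i (hν i), map_measureReal_apply (by fun_prop) hB']
    rfl
  have h1 := hcoord j hA
  have h2 := hcoord k hA.compl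
  rw [G.rootProb_compl hd μ t hA] at h2
  have h3 : (Measure.infinitePi fun _ : TreeWord d => (ν : Measure (Idx n → S))).real
      {x | treeEval (G.fullγ hd) t θ (fun w => x w j) ∈ A ∧
        treeEval (G.fullγ hd) t θ (fun w => x w k) ∈ Aᶜ} ≤ G.rootProb hd μ t A θ :=
    h1 ▸ measureReal_mono (fun x hx => hx.1)
  have h4 : (Measure.infinitePi fun _ : TreeWord d => (ν : Measure (Idx n → S))).real
      {x | treeEval (G.fullγ hd) t θ (fun w => x w j) ∈ A ∧
        treeEval (G.fullγ hd) t θ (fun w => x w k) ∈ Aᶜ} ≤ 1 - G.rootProb hd μ t A θ :=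
    h2 ▸ measureReal_mono (fun x hx => hx.2)
  have h5 := G.rootProb_nonneg hd μ t A θ
  have h6 := G.rootProb_le_one hd μ t A θ
  -- `min p (1 - p) ≤ 2 p (1 - p)` for `0 ≤ p ≤ 1`
  simp only
  rcases le_total (G.rootProb hd μ t A θ) (1 / 2) with h | h <;> nlinarith

end

end RandomMap

/-! ### Weak convergence to the diagonal -/

lemma exists_seq_boxes {S : Type u} [TopologicalSpace S] [SecondCountableTopology S]
    {ι : Type*} [Countable ι] [Nonempty ι] {U : Set (ι → S)} (hU : IsOpen U) :
    ∃ (F : ℕ → Finset ι) (V : ℕ → ι → Set S), (∀ m i, IsOpen (V m i)) ∧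
      U = ⋃ m, ((F m : Set ι)).pi (V m) := by
  classical
  rcases U.eq_empty_or_nonempty with rfl | hne
  · obtain ⟨i⟩ := ‹Nonempty ι›
    exact ⟨fun _ => {i}, fun _ _ => ∅, by simp, by ext; simp⟩
  have hb := isTopologicalBasis_pi (fun _ : ι => TopologicalSpace.isTopologicalBasis_opens (α := S))
  obtain ⟨B, hB, rfl⟩ := hb.open_eq_sUnion hU
  obtain ⟨T, hTc, hTB, hT⟩ := TopologicalSpace.isOpen_sUnion_countable B
    (fun s hs => hb.isOpen (hB hs))
  have hTne : T.Nonempty := by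
    rw [← hT] at hne
    obtain ⟨x, s, hs, -⟩ := hne
    exact ⟨s, hs⟩
  obtain ⟨f, rfl⟩ := hTc.exists_eq_range hTne
  have hf : ∀ m, ∃ (F : Finset ι) (V : ι → Set S), (∀ i, IsOpen (V i)) ∧
      f m = (F : Set ι).pi V := by
    intro m
    obtain ⟨V, F, hV, h⟩ := hB (hTB ⟨m, rfl⟩)
    refine ⟨F, fun i => if i ∈ F then V i else Set.univ, fun i => ?_, ?_⟩
    · dsimp only
      split_ifs with hi
      · exact hV i hi
      · exact isOpen_univ
    · rw [h]
      exact Set.pi_congr rfl fun i hi => by simp [Finset.mem_coe.1 hi]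
  choose F V hV h using hf
  refine ⟨F, V, hV, ?_⟩
  rw [← hT, Set.sUnion_range]
  exact Set.iUnion_congr h

/-- Laws with a fixed marginal under which no measurable set separates two coordinates,
asymptotically, converge weakly to the diagonal law. -/
lemma tendsto_diagLaw {S : Type u} [TopologicalSpace S] [SecondCountableTopology S]
    [MeasurableSpace S] [BorelSpace S] {n : ℕ∞} (j₀ : Idx n) (μ : ProbabilityMeasure S)
    (ν : ℕ → ProbabilityMeasure (Idx n → S))
    (hν : ∀ t, (ν t : Measure (Idx n → S)).map (fun y => y j₀) = μ)
    (h : ∀ (j : Idx n) (A : Set S), MeasurableSet A →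
      Tendsto (fun t => (ν t : Measure (Idx n → S)) {y | y j₀ ∈ A ∧ y j ∈ Aᶜ}) atTop (𝓝 0)) :
    Tendsto ν atTop (𝓝 (diagLaw n μ)) := by
  have : Nonempty (Idx n) := ⟨j₀⟩
  refine tendsto_of_forall_isOpen_le_liminf_nat' fun U hU => ?_
  obtain ⟨F, V, hV, hUV⟩ := exists_seq_boxes hU
  -- the event that the diagonal point over the coordinate `j₀` lies in `W`, but `y` does not
  let bad : Set (Idx n → S) → Set (Idx n → S) := fun W => {y | (fun _ => y j₀) ∈ W ∧ y ∉ W}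
  have hbox : ∀ m, Tendsto (fun t => (ν t : Measure (Idx n → S))
      (bad ((F m : Set (Idx n)).pi (V m)))) atTop (𝓝 0) := by
    intro m
    have hsum : Tendsto (fun t => ∑ j ∈ F m, (ν t : Measure (Idx n → S))
        {y | y j₀ ∈ V m j ∧ y j ∈ (V m j)ᶜ}) atTop (𝓝 0) := by
      simpa using tendsto_finsetSum (F m) fun j _ => h j (V m j) (hV m j).measurableSet
    refine tendsto_of_tendsto_of_tendsto_of_le_of_le tendsto_const_nhds hsum
      (fun _ => zero_le) fun t => ?_
    refine (measure_mono ?_).trans (measure_biUnion_finset_le (F m) _)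
    rintro y ⟨h1, h2⟩
    simp only [Set.mem_pi, not_forall] at h2
    obtain ⟨j, hj, hj'⟩ := h2
    exact Set.mem_biUnion hj ⟨h1 j hj, hj'⟩
  let W : ℕ → Set (Idx n → S) := fun m => (F m : Set (Idx n)).pi (V m)
  have hacc : ∀ m, Tendsto (fun t => (ν t : Measure (Idx n → S)) (bad (Set.accumulate W m)))
      atTop (𝓝 0) := by
    intro m
    have hsum : Tendsto (fun t => ∑ i ∈ Finset.range (m + 1), (ν t : Measure (Idx n → S))
        (bad (W i))) atTop (𝓝 0) := by
      simpa using tendsto_finsetSum (Finset.range (m + 1)) fun i _ => hbox i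
    refine tendsto_of_tendsto_of_tendsto_of_le_of_le tendsto_const_nhds hsum
      (fun _ => zero_le) fun t => ?_
    refine (measure_mono ?_).trans (measure_biUnion_finset_le _ _)
    rintro y ⟨h1, h2⟩
    simp only [Set.mem_accumulate, not_exists, not_and] at h1 h2
    obtain ⟨i, hi, hi'⟩ := h1
    exact Set.mem_biUnion (Finset.mem_coe.2 (Finset.mem_range.2 (by omega))) ⟨hi', h2 i hi⟩
  have hWo : ∀ m, IsOpen (W m) := fun m => isOpen_set_pi (F m).finite_toSet fun i _ => hV m i
  have hdiag : ∀ (t : ℕ) {B : Set (Idx n → S)}, IsOpen B →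
      (diagLaw n μ : Measure (Idx n → S)) B
        = (ν t : Measure (Idx n → S)) {y | (fun _ => y j₀) ∈ B} := by
    intro t B hB
    change ((μ : Measure S).map fun x _ => x) B = _
    rw [← hν t, Measure.map_map (by fun_prop) (by fun_prop),
      Measure.map_apply (by fun_prop) hB.measurableSet]
    rfl
  change _ ≤ liminf (fun t => (ν t : Measure (Idx n → S)) U) atTop
  have hU' : U = ⋃ m, W m := hUV
  conv_lhs => rw [hU']
  rw [measure_iUnion_eq_iSup_accumulate]
  refine iSup_le fun m => ?_
  have hopen : IsOpen (Set.accumulate W m) := by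
    rw [Set.accumulate_def]
    exact isOpen_biUnion fun i _ => hWo i
  set D := (diagLaw n μ : Measure (Idx n → S)) (Set.accumulate W m) with hD
  have hlim : Tendsto (fun t => D - (ν t : Measure (Idx n → S)) (bad (Set.accumulate W m)))
      atTop (𝓝 D) := by
    simpa using ENNReal.Tendsto.sub (tendsto_const_nhds (x := D)) (hacc m)
      (Or.inl (measure_ne_top _ _))
  rw [← hlim.liminf_eq]
  refine liminf_le_liminf (Eventually.of_forall fun t => ?_)
  rw [tsub_le_iff_right, hD, hdiag t hopen]
  refine (measure_mono ?_).trans (measure_union_le _ _)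
  intro y hy
  by_cases hy' : y ∈ Set.accumulate W m
  · left
    rw [hU']
    exact Set.accumulate_subset_iUnion m hy'
  · exact Or.inr ⟨hy, hy'⟩

/-! ### Continuity of `T^{(2)}` for convergence on rectangles -/

/-- Convergence of the probabilities of `u ⁻¹' C ∩ D` extends from a π-system of sets `C` to all
measurable sets, when the law of `u` does not depend on the measure: this excludes any loss of mass
in countable unions. -/
lemma tendsto_measureReal_inter_of_isPiSystem {Y Z : Type*} [MeasurableSpace Y]
    [mZ : MeasurableSpace Z] (Q : ℕ → Measure Y) (Q' : Measure Y)
    [∀ t, IsProbabilityMeasure (Q t)] [IsProbabilityMeasure Q'] {u : Y → Z} (hu : Measurable u)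
    (hQ : ∀ t, (Q t).map u = Q'.map u) {D : Set Y} (hD : MeasurableSet D)
    (hQD : Tendsto (fun t => (Q t).real D) atTop (𝓝 (Q'.real D)))
    {s : Set (Set Z)} (hs : mZ = MeasurableSpace.generateFrom s) (hpi : IsPiSystem s)
    (h : ∀ C ∈ s, Tendsto (fun t => (Q t).real (u ⁻¹' C ∩ D)) atTop (𝓝 (Q'.real (u ⁻¹' C ∩ D))))
    {C : Set Z} (hC : MeasurableSet C) :
    Tendsto (fun t => (Q t).real (u ⁻¹' C ∩ D)) atTop (𝓝 (Q'.real (u ⁻¹' C ∩ D))) := by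
  induction C, hC using MeasurableSpace.induction_on_inter hs hpi with
  | empty => simp
  | basic C hC => exact h C hC
  | compl C hC ih =>
    have key : ∀ R : Measure Y, IsProbabilityMeasure R →
        R.real (u ⁻¹' Cᶜ ∩ D) = R.real D - R.real (u ⁻¹' C ∩ D) := by
      intro R hR
      rw [← measureReal_inter_add_sdiff (μ := R) (s := D) (hu hC), Set.inter_comm D,
        add_sub_cancel_left]
      congr 1
      ext x
      simp [and_comm]
    simp_rw [key _ inferInstance]
    exact hQD.sub ih
  | iUnion f hdisj hf ih =>
    have key : ∀ R : Measure Y, IsProbabilityMeasure R →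
        HasSum (fun m => R.real (u ⁻¹' (f m) ∩ D)) (R.real (u ⁻¹' (⋃ m, f m) ∩ D)) := by
      intro R hR
      rw [Set.preimage_iUnion, Set.iUnion_inter, measureReal_def, measure_iUnion
        (fun i j hij => ((hdisj hij).preimage u).mono Set.inter_subset_left Set.inter_subset_left)
        (fun i => (hu (hf i)).inter hD)]
      rw [ENNReal.tsum_toReal_eq fun _ => measure_ne_top _ _]
      refine ENNReal.hasSum_toReal ?_
      rw [← measure_iUnion
        (fun i j hij => ((hdisj hij).preimage u).mono Set.inter_subset_left Set.inter_subset_left)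
        (fun i => (hu (hf i)).inter hD)]
      exact measure_ne_top _ _
    simp_rw [← fun R : Measure Y => fun hR : IsProbabilityMeasure R => (key R hR).tsum_eq]
    have : IsProbabilityMeasure (Q'.map u) := Measure.isProbabilityMeasure_map hu.aemeasurable
    have hbound : Summable (fun m => (Q'.map u).real (f m)) := by
      refine ENNReal.summable_toReal ?_
      rw [← measure_iUnion hdisj hf]
      exact measure_ne_top _ _
    refine tendsto_tsum_of_dominated_convergence hbound ih (Eventually.of_forall fun t m => ?_)
    rw [Real.norm_of_nonneg measureReal_nonneg, ← hQ t, map_measureReal_apply hu (hf m)]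
    exact measureReal_mono Set.inter_subset_left

section Rect

variable {S : Type u} [MeasurableSpace S]

/-- Convergence on rectangles, for laws on `S^2` with fixed marginals, carries over to infinite
products. -/
lemma tendsto_infinitePi_rect {I : Type*} {μ : ProbabilityMeasure S}
    {ν : ℕ → ProbabilityMeasure (Idx 2 → S)} {ν' : ProbabilityMeasure (Idx 2 → S)}
    (hν : ∀ t, ν t ∈ lawsWithMarginal 2 μ) (hν' : ν' ∈ lawsWithMarginal 2 μ)
    (h : ∀ A B : Set S, MeasurableSet A → MeasurableSet B → Tendsto
      (fun t => (ν t : Measure (Idx 2 → S)).real {y | y fstIdx ∈ A ∧ y sndIdx ∈ B}) atTop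
      (𝓝 ((ν' : Measure (Idx 2 → S)).real {y | y fstIdx ∈ A ∧ y sndIdx ∈ B})))
    {C D : Set (I → S)} (hC : MeasurableSet C) (hD : MeasurableSet D) :
    Tendsto (fun t => (Measure.infinitePi fun _ : I => (ν t : Measure (Idx 2 → S))).real
        {x | (fun i => x i fstIdx) ∈ C ∧ (fun i => x i sndIdx) ∈ D}) atTop
      (𝓝 ((Measure.infinitePi fun _ : I => (ν' : Measure (Idx 2 → S))).real
        {x | (fun i => x i fstIdx) ∈ C ∧ (fun i => x i sndIdx) ∈ D})) := by
  classical
  let u : Idx 2 → (I → Idx 2 → S) → (I → S) := fun j x i => x i j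
  have hu : ∀ j, Measurable (u j) := fun j => by fun_prop
  have hmap : ∀ j t, (Measure.infinitePi fun _ : I => (ν t : Measure (Idx 2 → S))).map (u j)
      = (Measure.infinitePi fun _ : I => (ν' : Measure (Idx 2 → S))).map (u j) := by
    intro j t
    rw [map_coord_infinitePi μ j (hν t j), map_coord_infinitePi μ j (hν' j)]
  have hconst : ∀ (j : Idx 2) {E : Set (I → S)}, MeasurableSet E → Tendsto
      (fun t => (Measure.infinitePi fun _ : I => (ν t : Measure (Idx 2 → S))).real (u j ⁻¹' E))
      atTop
      (𝓝 ((Measure.infinitePi fun _ : I => (ν' : Measure (Idx 2 → S))).real (u j ⁻¹' E))) := by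
    intro j E hE
    simp_rw [← map_measureReal_apply (hu j) hE, hmap]
    exact tendsto_const_nhds
  let s : Set (Set (I → S)) := squareCylinders fun _ : I => {A : Set S | MeasurableSet A}
  have hs : MeasurableSpace.pi = MeasurableSpace.generateFrom s :=
    generateFrom_squareCylinders.symm
  have hpi : IsPiSystem s := isPiSystem_squareCylinders
    (fun _ => MeasurableSpace.isPiSystem_measurableSet) (fun _ => MeasurableSet.univ)
  have hsm : ∀ E ∈ s, MeasurableSet E := fun E hE => by
    exact hs ▸ MeasurableSpace.measurableSet_generateFrom hE
  have hbox : ∀ C ∈ s, ∀ D ∈ s, Tendsto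
      (fun t => (Measure.infinitePi fun _ : I => (ν t : Measure (Idx 2 → S))).real
        (u fstIdx ⁻¹' C ∩ u sndIdx ⁻¹' D)) atTop
      (𝓝 ((Measure.infinitePi fun _ : I => (ν' : Measure (Idx 2 → S))).real
        (u fstIdx ⁻¹' C ∩ u sndIdx ⁻¹' D))) := by
    rintro _ ⟨F₁, A, hA, rfl⟩ _ ⟨F₂, B, hB, rfl⟩
    have hA' : ∀ i, MeasurableSet (A i) := fun i => hA i (Set.mem_univ i)
    have hB' : ∀ i, MeasurableSet (B i) := fun i => hB i (Set.mem_univ i)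
    let A' : I → Set S := fun i => if i ∈ F₁ then A i else Set.univ
    let B' : I → Set S := fun i => if i ∈ F₂ then B i else Set.univ
    have hAm : ∀ i, MeasurableSet (A' i) := fun i => by
      simp only [A']; split_ifs
      · exact hA' i
      · exact .univ
    have hBm : ∀ i, MeasurableSet (B' i) := fun i => by
      simp only [B']; split_ifs
      · exact hB' i
      · exact .univ
    have hset : u fstIdx ⁻¹' ((F₁ : Set I).pi A) ∩ u sndIdx ⁻¹' ((F₂ : Set I).pi B)
        = ((F₁ ∪ F₂ : Finset I) : Set I).pi
          (fun i => {y : Idx 2 → S | y fstIdx ∈ A' i ∧ y sndIdx ∈ B' i}) := by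
      ext x
      simp only [Set.mem_inter_iff, Set.mem_preimage, Set.mem_pi, u, A', B', Finset.coe_union,
        Set.mem_union, Finset.mem_coe, Set.mem_ofPred_eq]
      constructor
      · rintro ⟨h1, h2⟩ i hi
        constructor
        · split_ifs with h3
          · exact h1 i h3
          · trivial
        · split_ifs with h3
          · exact h2 i h3
          · trivial
      · intro h
        constructor
        · intro i hi
          simpa [hi] using (h i (Or.inl hi)).1
        · intro i hi
          simpa [hi] using (h i (Or.inr hi)).2
    have hm : ∀ i ∈ F₁ ∪ F₂, MeasurableSet {y : Idx 2 → S | y fstIdx ∈ A' i ∧ y sndIdx ∈ B' i} :=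
      fun i _ => measurableSet_rect (hAm i) (hBm i)
    simp only [hset, measureReal_def]
    simp_rw [Measure.infinitePi_pi _ hm, ENNReal.toReal_prod]
    exact tendsto_finsetProd _ fun i _ => h (A' i) (B' i) (hAm i) (hBm i)
  have hstep : ∀ C, MeasurableSet C → ∀ D ∈ s, Tendsto
      (fun t => (Measure.infinitePi fun _ : I => (ν t : Measure (Idx 2 → S))).real
        (u fstIdx ⁻¹' C ∩ u sndIdx ⁻¹' D)) atTop
      (𝓝 ((Measure.infinitePi fun _ : I => (ν' : Measure (Idx 2 → S))).real
        (u fstIdx ⁻¹' C ∩ u sndIdx ⁻¹' D))) := fun C hC D hD =>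
    tendsto_measureReal_inter_of_isPiSystem _ _ (hu fstIdx) (hmap fstIdx)
      (hu sndIdx (hsm D hD)) (hconst sndIdx (hsm D hD)) hs hpi (fun C hC => hbox C hC D hD) hC
  have hfinal := tendsto_measureReal_inter_of_isPiSystem _ _ (hu sndIdx) (hmap sndIdx)
      (hu fstIdx hC) (hconst fstIdx hC) hs hpi
      (fun D hD => by simpa only [Set.inter_comm] using hstep C hC D hD) hD
  simp only [Set.inter_comm (u sndIdx ⁻¹' D)] at hfinal
  exact hfinal

end Rect

namespace RandomMap

variable {Ω : Type v} {S : Type u} [MeasurableSpace Ω] [MeasurableSpace S]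

lemma T2_rect (G : RandomMap Ω S) (r : ProbabilityMeasure Ω) {d : ℕ∞}
    (hd : ∀ ω, G.κ ω ≤ d) (ν : ProbabilityMeasure (Idx 2 → S)) {A B : Set S}
    (hA : MeasurableSet A) (hB : MeasurableSet B) :
    (G.Tn r 2 ν : Measure (Idx 2 → S)).real {y | y fstIdx ∈ A ∧ y sndIdx ∈ B}
      = ∫ ω, (Measure.infinitePi fun _ : Idx d => (ν : Measure (Idx 2 → S))).real
        {x | (fun i => x i fstIdx) ∈ {z | G.fullγ hd (ω, z) ∈ A} ∧
          (fun i => x i sndIdx) ∈ {z | G.fullγ hd (ω, z) ∈ B}} ∂(r : Measure Ω) := by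
  have hd' : ∀ ω, (G.nvariate 2).κ ω ≤ d := hd
  have hm := (G.nvariate 2).measurable_fullγ hd'
  have hset := measurableSet_rect hA hB
  rw [Tn, (G.nvariate 2).T_eq_map r hd', measureReal_def, Measure.map_apply hm hset,
    Measure.prod_apply (hm hset), ← integral_toReal
      (measurable_measure_prodMk_left (hm hset)).aemeasurable (by simp)]
  rfl

/-- Although `T^{(2)}` need not be continuous for weak convergence, it preserves convergence on
rectangles of laws with fixed marginals. -/
lemma tendsto_T2_rect (G : RandomMap Ω S) (r : ProbabilityMeasure Ω) {μ : ProbabilityMeasure S}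
    {ν : ℕ → ProbabilityMeasure (Idx 2 → S)} {ν' : ProbabilityMeasure (Idx 2 → S)}
    (hν : ∀ t, ν t ∈ lawsWithMarginal 2 μ) (hν' : ν' ∈ lawsWithMarginal 2 μ)
    (h : ∀ A B : Set S, MeasurableSet A → MeasurableSet B → Tendsto
      (fun t => (ν t : Measure (Idx 2 → S)).real {y | y fstIdx ∈ A ∧ y sndIdx ∈ B}) atTop
      (𝓝 ((ν' : Measure (Idx 2 → S)).real {y | y fstIdx ∈ A ∧ y sndIdx ∈ B})))
    {A B : Set S} (hA : MeasurableSet A) (hB : MeasurableSet B) :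
    Tendsto
      (fun t => (G.Tn r 2 (ν t) : Measure (Idx 2 → S)).real {y | y fstIdx ∈ A ∧ y sndIdx ∈ B}) atTop
      (𝓝 ((G.Tn r 2 ν' : Measure (Idx 2 → S)).real {y | y fstIdx ∈ A ∧ y sndIdx ∈ B})) := by
  have hd : ∀ ω, G.κ ω ≤ ⊤ := fun _ => le_top
  simp_rw [G.T2_rect r hd _ hA hB]
  have hm := (G.nvariate 2).measurable_fullγ (d := ⊤) hd
  have hset := measurableSet_rect hA hB
  refine tendsto_integral_of_dominated_convergence (fun _ => 1) (fun t => ?_)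
    (integrable_const _) (fun t => Eventually.of_forall fun ω => ?_)
    (Eventually.of_forall fun ω => ?_)
  · exact (measurable_measure_prodMk_left
      (ν := Measure.infinitePi fun _ : Idx ⊤ => (ν t : Measure (Idx 2 → S)))
      (hm hset)).ennreal_toReal.aestronglyMeasurable
  · rw [Real.norm_of_nonneg measureReal_nonneg]
    exact measureReal_le_one
  · have hω : Measurable fun z => G.fullγ hd (ω, z) :=
      (G.measurable_fullγ hd).comp (by fun_prop)
    exact tendsto_infinitePi_rect hν hν' h (hω hA) (hω hB)

end RandomMap

/-- A law on `S^2` is determined by its values on rectangles. -/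
lemma ext_of_rect {S : Type u} [MeasurableSpace S] {ν ν' : Measure (Idx 2 → S)}
    [IsProbabilityMeasure ν] [IsProbabilityMeasure ν']
    (h : ∀ A B : Set S, MeasurableSet A → MeasurableSet B →
      ν.real {y | y fstIdx ∈ A ∧ y sndIdx ∈ B} = ν'.real {y | y fstIdx ∈ A ∧ y sndIdx ∈ B}) :
    ν = ν' := by
  classical
  refine ext_of_generate_finite _ (generateFrom_squareCylinders
    (α := fun _ : Idx 2 => S)).symm (isPiSystem_squareCylinders
    (fun _ => MeasurableSpace.isPiSystem_measurableSet) (fun _ => MeasurableSet.univ)) ?_ (by simp)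
  rintro _ ⟨F, A, hA, rfl⟩
  let A' : Idx 2 → Set S := fun i => if i ∈ F then A i else Set.univ
  have hAm : ∀ i, MeasurableSet (A' i) := fun i => by
    simp only [A']; split_ifs
    · exact hA i (Set.mem_univ i)
    · exact .univ
  have hset : (F : Set (Idx 2)).pi A = {y | y fstIdx ∈ A' fstIdx ∧ y sndIdx ∈ A' sndIdx} := by
    ext y
    simp only [Set.mem_pi, A', Finset.mem_coe, Set.mem_ofPred_eq]
    constructor
    · intro hy
      constructor <;> split_ifs with h3
      exacts [hy _ h3, trivial, hy _ h3, trivial]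
    · rintro ⟨h1, h2⟩ i hi
      rcases idx_two_cases i with rfl | rfl
      · simpa [hi] using h1
      · simpa [hi] using h2
  rw [hset]
  exact (measureReal_eq_measureReal_iff).1 (h _ _ (hAm _) (hAm _))

/-! ### Existence of recursive tree processes -/

/-- A point `e` with law `ρ` can be sampled by first sampling its image under `g`, and then using an
independent uniform variable. -/
lemma exists_randomized_section {E S : Type*} [MeasurableSpace E] [StandardBorelSpace E]
    [Nonempty E] [MeasurableSpace S] [StandardBorelSpace S] (ρ : Measure E) [IsProbabilityMeasure ρ]
    {g : E → S} (hg : Measurable g) :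
    ∃ h : S × unitInterval → E, MeasurePreserving h ((ρ.map g).prod volume) ρ ∧
      ∀ᵐ p ∂((ρ.map g).prod volume), g (h p) = p.1 := by
  have : IsProbabilityMeasure (ρ.map g) := Measure.isProbabilityMeasure_map hg.aemeasurable
  obtain ⟨f, hf, hfR⟩ := (condDistrib id g ρ).exists_measurable_map_eq_unitInterval
  have hjoint : ((ρ.map g).prod volume).map (fun p => (p.1, Function.uncurry f p))
      = ρ.map (fun e => (g e, e)) := by
    have h1 : (ρ.map g) ⊗ₘ condDistrib id g ρ = ρ.map (fun e => (g e, e)) :=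
      compProd_map_condDistrib aemeasurable_id
    rw [← h1]
    ext s hs
    have hm : Measurable (fun p : S × unitInterval => (p.1, Function.uncurry f p)) :=
      measurable_fst.prodMk hf
    rw [Measure.map_apply hm hs, Measure.prod_apply (hm hs), Measure.compProd_apply hs]
    refine lintegral_congr fun x => ?_
    rw [← hfR, Measure.map_apply hf.of_uncurry_left (measurable_prodMk_left hs)]
    rfl
  refine ⟨Function.uncurry f, ⟨hf, ?_⟩, ?_⟩
  · have h2 := congrArg (Measure.map Prod.snd) hjoint
    rw [Measure.map_map measurable_snd (measurable_fst.prodMk hf),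
      Measure.map_map measurable_snd
        (show Measurable (fun e => (g e, e)) from hg.prodMk measurable_id)] at h2
    simpa [Function.comp_def] using h2
  · have h3 : ∀ᵐ q ∂(ρ.map (fun e => (g e, e))), g q.2 = q.1 := by
      have hm : MeasurableSet {q : S × E | g q.2 = q.1} :=
        measurableSet_eq_fun (hg.comp measurable_snd) measurable_fst
      rw [ae_map_iff (f := fun e => (g e, e)) (hg.prodMk measurable_id).aemeasurable hm]
      exact Eventually.of_forall fun _ => rfl
    rw [← hjoint] at h3
    exact ae_of_ae_map (measurable_fst.prodMk hf).aemeasurable h3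

lemma measurePreserving_infinitePi_map {ι E F : Type*} [MeasurableSpace E] [MeasurableSpace F]
    {ρ : Measure E} [IsProbabilityMeasure ρ] {σ : Measure F} {f : E → F}
    (hf : MeasurePreserving f ρ σ) :
    MeasurePreserving (fun (x : ι → E) i => f (x i)) (Measure.infinitePi fun _ : ι => ρ)
      (Measure.infinitePi fun _ : ι => σ) := by
  have hm := hf.measurable
  refine ⟨by fun_prop, ?_⟩
  rw [Measure.infinitePi_map_pi (fun _ : ι => ρ) (f := fun _ => f) (fun _ => hm)]
  simp_rw [hf.map_eq]

lemma measurePreserving_rootSplit {I E : Type*} [MeasurableSpace E] (ρ : Measure E)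
    [IsProbabilityMeasure ρ] :
    MeasurePreserving (fun z : List I → E => (z [], fun j w => z (j :: w)))
      (Measure.infinitePi (fun _ : List I => ρ))
      (ρ.prod (Measure.infinitePi fun _ : I => Measure.infinitePi fun _ : List I => ρ)) :=
  ⟨by fun_prop, map_rootSplit ρ⟩

lemma measurePreserving_glueTree {I E : Type*} [MeasurableSpace E] (ρ : Measure E)
    [IsProbabilityMeasure ρ] :
    MeasurePreserving (glueTree (I := I) (E := E))
      (ρ.prod (Measure.infinitePi fun _ : I => Measure.infinitePi fun _ : List I => ρ))
      (Measure.infinitePi (fun _ : List I => ρ)) :=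
  ⟨measurable_glueTree, map_glueTree ρ⟩

section TopDown

variable {Ω S I : Type*}

/-- The sample space of the top-down construction of a recursive tree process: the value at the
root together with labels at all vertices. The label at a vertex consists of the uniform variable
used to sample its descendants, and of a spare element of `Ω × S` which does not influence the
process. -/
abbrev TopDown (Ω S I : Type*) : Type _ := S × (List I → unitInterval × (Ω × S))

/-- The subtree at the child `j` of the root. The function `h` samples the randomness at a vertex
and the values at its children, given the value at the vertex and a uniform variable. -/
def TopDown.child (h : S × unitInterval → Ω × (I → S)) (j : I) (a : TopDown Ω S I) :
    TopDown Ω S I :=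
  ((h (a.1, (a.2 []).1)).2 j, fun w => a.2 (j :: w))

/-- The subtree at the vertex `w`. -/
def TopDown.subtree (h : S × unitInterval → Ω × (I → S)) : List I → TopDown Ω S I → TopDown Ω S I
  | [], a => a
  | j :: w, a => subtree h w (child h j a)

/-- The randomness at the root. -/
def TopDown.rootRand (h : S × unitInterval → Ω × (I → S)) (a : TopDown Ω S I) : Ω :=
  (h (a.1, (a.2 []).1)).1

lemma TopDown.subtree_append (h : S × unitInterval → Ω × (I → S)) (w : List I) (j : I)
    (a : TopDown Ω S I) : subtree h (w ++ [j]) a = child h j (subtree h w a) := by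
  induction w generalizing a with
  | nil => rfl
  | cons i w ih => exact ih _

/-- The labelled tree whose `Ω`-labels at depths `< t` and whose `S`-labels at depth `t` are those
of the recursive tree process, and whose other labels are the spare ones. -/
def TopDown.level (h : S × unitInterval → Ω × (I → S)) : ℕ → TopDown Ω S I → List I → Ω × S
  | 0, a => glueTree (((a.2 []).2.1, a.1), fun j w => (a.2 (j :: w)).2)
  | t + 1, a => glueTree ((rootRand h a, (a.2 []).2.2), fun j => level h t (child h j a))

lemma TopDown.level_fst (h : S × unitInterval → Ω × (I → S)) (t : ℕ) (a : TopDown Ω S I)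
    (w : List I) (hw : w.length < t) : (level h t a w).1 = rootRand h (subtree h w a) := by
  induction t generalizing a w with
  | zero => simp at hw
  | succ t ih =>
    match w with
    | [] => rfl
    | j :: w => exact ih (child h j a) w (by simpa using hw)

lemma TopDown.level_snd (h : S × unitInterval → Ω × (I → S)) (t : ℕ) (a : TopDown Ω S I)
    (w : List I) (hw : w.length = t) : (level h t a w).2 = (subtree h w a).1 := by
  induction t generalizing a w with
  | zero =>
    rw [List.length_eq_zero_iff] at hw
    subst hw
    rfl
  | succ t ih =>
    match w with
    | [] => simp at hw
    | j :: w => exact ih (child h j a) w (by simpa using hw)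

variable [MeasurableSpace Ω] [MeasurableSpace S]

/-- The law of the top-down construction: the root value has law `μ`, and all labels are
independent. -/
noncomputable def TopDown.law (I : Type*) (r : Measure Ω) (μ : Measure S) :
    Measure (TopDown Ω S I) :=
  μ.prod (Measure.infinitePi fun _ : List I => (volume : Measure unitInterval).prod (r.prod μ))

instance (I : Type*) (r : Measure Ω) (μ : Measure S) [IsProbabilityMeasure r]
    [IsProbabilityMeasure μ] : IsProbabilityMeasure (TopDown.law I r μ) := by
  unfold TopDown.law; infer_instance

variable {r : Measure Ω} {μ : Measure S} [IsProbabilityMeasure r] [IsProbabilityMeasure μ]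
  {h : S × unitInterval → Ω × (I → S)}

lemma TopDown.measurable_rootRand (hm : Measurable h) : Measurable (rootRand h) := by
  unfold rootRand
  fun_prop

/-- The randomness at the root is independent of the subtrees at the children, which are i.i.d.
with the law of the whole tree. -/
lemma TopDown.measurePreserving_step
    (hh : MeasurePreserving h (μ.prod volume) (r.prod (Measure.infinitePi fun _ : I => μ))) :
    MeasurePreserving
      (fun a : TopDown Ω S I => (rootRand h a, ((a.2 []).2, fun j => child h j a)))
      (law I r μ) (r.prod ((r.prod μ).prod (Measure.infinitePi fun _ : I => law I r μ))) := by
  let ρ := (volume : Measure unitInterval).prod (r.prod μ)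
  let Z := Measure.infinitePi fun _ : I => Measure.infinitePi fun _ : List I => ρ
  let M := Measure.infinitePi fun _ : I => μ
  have s1 : MeasurePreserving _ (law I r μ) (μ.prod (ρ.prod Z)) :=
    (MeasurePreserving.id μ).prod (measurePreserving_rootSplit (I := I) ρ)
  have s2 : MeasurePreserving _ (μ.prod (ρ.prod Z)) (μ.prod (volume.prod ((r.prod μ).prod Z))) :=
    (MeasurePreserving.id μ).prod (measurePreserving_prodAssoc _ _ _)
  have s3 : MeasurePreserving _ (μ.prod (volume.prod ((r.prod μ).prod Z)))
      ((μ.prod (volume : Measure unitInterval)).prod ((r.prod μ).prod Z)) :=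
    (measurePreserving_prodAssoc _ _ _).symm
  have s4 : MeasurePreserving _ ((μ.prod (volume : Measure unitInterval)).prod ((r.prod μ).prod Z))
      ((r.prod M).prod ((r.prod μ).prod Z)) :=
    hh.prod (MeasurePreserving.id _)
  have s5 : MeasurePreserving _ ((r.prod M).prod ((r.prod μ).prod Z))
      (r.prod (M.prod ((r.prod μ).prod Z))) :=
    measurePreserving_prodAssoc _ _ _
  have s6 : MeasurePreserving _ (M.prod ((r.prod μ).prod Z)) (M.prod (Z.prod (r.prod μ))) :=
    (MeasurePreserving.id _).prod Measure.measurePreserving_swap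
  have s7 : MeasurePreserving _ (M.prod (Z.prod (r.prod μ))) ((M.prod Z).prod (r.prod μ)) :=
    (measurePreserving_prodAssoc _ _ _).symm
  have s8 : MeasurePreserving _ ((M.prod Z).prod (r.prod μ))
      ((Measure.infinitePi fun _ : I => law I r μ).prod (r.prod μ)) :=
    MeasurePreserving.prod (f := fun p i => (p.1 i, p.2 i)) ⟨by fun_prop, infinitePi_map_zip _ _⟩
      (MeasurePreserving.id _)
  have s9 : MeasurePreserving _ ((Measure.infinitePi fun _ : I => law I r μ).prod (r.prod μ))
      ((r.prod μ).prod (Measure.infinitePi fun _ : I => law I r μ)) :=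
    Measure.measurePreserving_swap
  exact ((MeasurePreserving.id r).prod (s9.comp (s8.comp (s7.comp s6)))).comp
    (s5.comp (s4.comp (s3.comp (s2.comp s1))))

lemma TopDown.measurePreserving_child
    (hh : MeasurePreserving h (μ.prod volume) (r.prod (Measure.infinitePi fun _ : I => μ)))
    (j : I) : MeasurePreserving (child h j) (law I r μ) (law I r μ) :=
  (measurePreserving_eval_infinitePi (fun _ : I => law I r μ) j).comp
    (measurePreserving_snd.comp (measurePreserving_snd.comp (measurePreserving_step hh)))

lemma TopDown.measurePreserving_subtree
    (hh : MeasurePreserving h (μ.prod volume) (r.prod (Measure.infinitePi fun _ : I => μ)))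
    (w : List I) : MeasurePreserving (subtree h w) (law I r μ) (law I r μ) := by
  induction w with
  | nil => exact MeasurePreserving.id _
  | cons j w ih => exact ih.comp (measurePreserving_child hh j)

lemma TopDown.measurePreserving_level
    (hh : MeasurePreserving h (μ.prod volume) (r.prod (Measure.infinitePi fun _ : I => μ)))
    (t : ℕ) : MeasurePreserving (level h t) (law I r μ)
      (Measure.infinitePi fun _ : List I => r.prod μ) := by
  induction t with
  | zero =>
    let ρ := (volume : Measure unitInterval).prod (r.prod μ)
    let Z := Measure.infinitePi fun _ : I => Measure.infinitePi fun _ : List I => ρ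
    let Z' := Measure.infinitePi fun _ : I => Measure.infinitePi fun _ : List I => r.prod μ
    have s1 : MeasurePreserving _ (law I r μ) (μ.prod (ρ.prod Z)) :=
      (MeasurePreserving.id μ).prod (measurePreserving_rootSplit (I := I) ρ)
    have hρ : MeasurePreserving (fun q : unitInterval × (Ω × S) => q.2.1) ρ r :=
      measurePreserving_fst.comp measurePreserving_snd
    have hZ : MeasurePreserving (fun (y : I → List I → unitInterval × (Ω × S)) i w => (y i w).2)
        Z Z' :=
      measurePreserving_infinitePi_map (measurePreserving_infinitePi_map measurePreserving_snd)
    have s2 : MeasurePreserving _ (μ.prod (ρ.prod Z)) (μ.prod (r.prod Z')) :=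
      (MeasurePreserving.id μ).prod (hρ.prod hZ)
    have s3 : MeasurePreserving _ (μ.prod (r.prod Z')) ((μ.prod r).prod Z') :=
      (measurePreserving_prodAssoc _ _ _).symm
    have s4 : MeasurePreserving _ ((μ.prod r).prod Z') ((r.prod μ).prod Z') :=
      Measure.measurePreserving_swap.prod (MeasurePreserving.id _)
    exact (measurePreserving_glueTree _).comp (s4.comp (s3.comp (s2.comp s1)))
  | succ t ih =>
    let Z' := Measure.infinitePi fun _ : I => Measure.infinitePi fun _ : List I => r.prod μ
    have s1 := measurePreserving_step hh
    have s2 : MeasurePreserving _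
        (r.prod ((r.prod μ).prod (Measure.infinitePi fun _ : I => law I r μ)))
        (r.prod (μ.prod Z')) :=
      (MeasurePreserving.id r).prod
        (measurePreserving_snd.prod (measurePreserving_infinitePi_map ih))
    have s3 : MeasurePreserving _ (r.prod (μ.prod Z')) ((r.prod μ).prod Z') :=
      (measurePreserving_prodAssoc _ _ _).symm
    exact (measurePreserving_glueTree _).comp (s3.comp (s2.comp s1))

/-- The randomness at all vertices is i.i.d. -/
lemma TopDown.measurePreserving_rand
    (hh : MeasurePreserving h (μ.prod volume) (r.prod (Measure.infinitePi fun _ : I => μ))) :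
    MeasurePreserving (fun (a : TopDown Ω S I) w => rootRand h (subtree h w a)) (law I r μ)
      (Measure.infinitePi fun _ : List I => r) := by
  have hm : Measurable (fun (a : TopDown Ω S I) (w : List I) => rootRand h (subtree h w a)) :=
    measurable_pi_lambda _ fun w =>
      (measurable_rootRand hh.measurable).comp (measurePreserving_subtree hh w).measurable
  refine ⟨hm, Measure.eq_infinitePi _ fun s t ht => ?_⟩
  have hpi : MeasurableSet ((s : Set (List I)).pi t) :=
    MeasurableSet.pi s.countable_toSet fun i _ => ht i
  -- only finitely many vertices are involved, and these are shallower than some depth `N`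
  obtain ⟨N, hN⟩ : ∃ N, ∀ w ∈ s, w.length < N :=
    ⟨s.sup List.length + 1, fun w hw => Nat.lt_succ_of_le (Finset.le_sup (f := List.length) hw)⟩
  have hlev : MeasurePreserving (fun a w => (level h N a w).1) (law I r μ)
      (Measure.infinitePi fun _ : List I => r) :=
    (measurePreserving_infinitePi_map measurePreserving_fst).comp (measurePreserving_level hh N)
  rw [← Measure.infinitePi_pi (fun _ : List I => r) (fun i _ => ht i), ← hlev.map_eq,
    Measure.map_apply hm hpi, Measure.map_apply hlev.measurable hpi]
  congr 1
  ext a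
  simp only [Set.mem_preimage, Set.mem_pi]
  exact forall₂_congr fun w hw => by rw [level_fst h N a w (hN w hw)]

end TopDown

namespace RandomMap

variable {Ω : Type v} {S : Type u} [MeasurableSpace Ω] [MeasurableSpace S]

/-- A recursive tree process exists on the path space. It is sampled from the root downwards: given
the value `x` at a vertex, its randomness and the values at its children are sampled from the
conditional law of `(ω, (X_j)_j)` given `γ[ω]((X_j)_j) = x`. -/
lemma exists_isRTP [StandardBorelSpace Ω] [StandardBorelSpace S] (G : RandomMap Ω S)
    (r : ProbabilityMeasure Ω) {d : ℕ∞} (hd : ∀ ω, G.κ ω ≤ d) {μ : ProbabilityMeasure S}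
    (hμ : G.T r μ = μ) :
    ∃ P : ProbabilityMeasure (TreeWord d → Ω × S),
      G.IsRTP r hd μ (P : Measure (TreeWord d → Ω × S)) (fun i z => (z i).1)
        (fun i z => (z i).2) := by
  have : Nonempty Ω := r.nonempty
  have : Nonempty S := μ.nonempty
  have hg := G.measurable_fullγ hd
  obtain ⟨h, hh, hrec⟩ := exists_randomized_section
    ((r : Measure Ω).prod (Measure.infinitePi fun _ : Idx d => (μ : Measure S))) hg
  rw [← G.T_eq_map r hd μ, hμ] at hh hrec
  let Q := TopDown.law (Idx d) (r : Measure Ω) (μ : Measure S)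
  let Φ : TopDown Ω S (Idx d) → TreeWord d → Ω × S := fun a w =>
    (TopDown.rootRand h (TopDown.subtree h w a), (TopDown.subtree h w a).1)
  have hΦ : Measurable Φ := measurable_pi_lambda _ fun w =>
    ((TopDown.measurable_rootRand hh.measurable).comp
      (TopDown.measurePreserving_subtree hh w).measurable).prodMk
      (measurable_fst.comp (TopDown.measurePreserving_subtree hh w).measurable)
  have hP : IsProbabilityMeasure (Q.map Φ) := Measure.isProbabilityMeasure_map hΦ.aemeasurable
  have hW : (Q.map Φ).map (fun z i => (z i).1) = Measure.infinitePi fun _ => (r : Measure Ω) := by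
    rw [Measure.map_map (by fun_prop) hΦ]
    exact (TopDown.measurePreserving_rand hh).map_eq
  have hlawW : ∀ i, (Q.map Φ).map (fun z => (z i).1) = r := fun i => by
    have h1 := congrArg (Measure.map (fun x : TreeWord d → Ω => x i)) hW
    rw [Measure.infinitePi_map_eval, Measure.map_map (by fun_prop) (by fun_prop)] at h1
    exact h1
  have hX : ∀ t, (Q.map Φ).map (fun z (i : {i : TreeWord d // i.length = t}) => (z i.1).2)
      = Measure.infinitePi fun _ => (μ : Measure S) := fun t => by
    have h1 : MeasurePreserving
        (fun a (i : {i : TreeWord d // i.length = t}) => (TopDown.level h t a i.1).2) Q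
        (Measure.infinitePi fun _ => (μ : Measure S)) := by
      have h2 := (measurePreserving_infinitePi_map (ι := TreeWord d)
        (measurePreserving_snd (μ := (r : Measure Ω)) (ν := (μ : Measure S)))).comp
        (TopDown.measurePreserving_level hh t)
      have h3 : MeasurePreserving
          (fun (x : TreeWord d → S) (i : {i : TreeWord d // i.length = t}) => x i.1)
          (Measure.infinitePi fun _ => (μ : Measure S))
          (Measure.infinitePi fun _ => (μ : Measure S)) :=
        ⟨by fun_prop, Measure.map_infinitePi_infinitePi_of_inj
          (P := fun _ : TreeWord d => (μ : Measure S)) Subtype.val_injective⟩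
      exact h3.comp h2
    rw [Measure.map_map (by fun_prop) hΦ, ← h1.map_eq]
    congr 1
    ext a i
    exact (TopDown.level_snd h t a i.1 i.2).symm
  have hlawX : ∀ i : TreeWord d, (Q.map Φ).map (fun z => (z i).2) = μ := fun i => by
    rw [Measure.map_map (by fun_prop) hΦ]
    exact (measurePreserving_fst.comp (TopDown.measurePreserving_subtree hh i)).map_eq
  refine ⟨⟨Q.map Φ, hP⟩, ⟨fun i => by fun_prop, fun i => by fun_prop, ?_, hlawW, fun t _ => ?_,
    fun t _ i _ => hlawX i, fun t _ => ?_, fun i => ?_⟩⟩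
  · change iIndepFun _ (Q.map Φ)
    rw [iIndepFun_iff_map_fun_eq_infinitePi_map (fun i => by fun_prop)]
    simp_rw [hlawW, hW]
  · change iIndepFun _ (Q.map Φ)
    rw [iIndepFun_iff_map_fun_eq_infinitePi_map (fun i => by fun_prop)]
    simp_rw [hlawX, hX]
  · let N := Measure.infinitePi fun _ : TreeWord d => (r : Measure Ω).prod (μ : Measure S)
    let f₁ : (TreeWord d → Ω × S) → {i : TreeWord d // i.length = t} → S := fun z i => (z i.1).2
    let f₂ : (TreeWord d → Ω × S) → {i : TreeWord d // i.length < t} → Ω := fun z i => (z i.1).1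
    have hf₁ : Measurable f₁ := by fun_prop
    have hf₂ : Measurable f₂ := by fun_prop
    have hind : IndepFun f₁ f₂ N := by
      have h1 : IndepFun (fun (z : TreeWord d → Ω × S) (i : TreeWord d) => (z i).2)
          (fun z i => (z i).1) N := by
        refine IndepFun.symm ((indepFun_iff_map_prod_eq_prod_map_map
          (Measurable.aemeasurable (by fun_prop)) (Measurable.aemeasurable (by fun_prop))).2 ?_)
        rw [infinitePi_map_unzip, (measurePreserving_infinitePi_map measurePreserving_fst).map_eq,
          (measurePreserving_infinitePi_map measurePreserving_snd).map_eq]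
      exact h1.comp (φ := fun x (i : {i : TreeWord d // i.length = t}) => x i.1)
        (ψ := fun x (i : {i : TreeWord d // i.length < t}) => x i.1) (by fun_prop) (by fun_prop)
    have hjoint : (Q.map Φ).map (fun z => (f₁ z, f₂ z)) = N.map (fun z => (f₁ z, f₂ z)) := by
      have hl : MeasurePreserving (TopDown.level h t) Q N := TopDown.measurePreserving_level hh t
      rw [Measure.map_map (by fun_prop) hΦ, ← hl.map_eq,
        Measure.map_map (by fun_prop) hl.measurable]
      congr 1
      ext a i
      · exact (TopDown.level_snd h t a i.1 i.2).symm
      · exact (TopDown.level_fst h t a i.1 i.2).symm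
    have h1 := congrArg (Measure.map Prod.fst) hjoint
    have h2 := congrArg (Measure.map Prod.snd) hjoint
    rw [Measure.map_map measurable_fst (by fun_prop),
      Measure.map_map measurable_fst (by fun_prop)] at h1
    rw [Measure.map_map measurable_snd (by fun_prop),
      Measure.map_map measurable_snd (by fun_prop)] at h2
    change IndepFun f₁ f₂ (Q.map Φ)
    rw [indepFun_iff_map_prod_eq_prod_map_map hf₁.aemeasurable hf₂.aemeasurable] at hind ⊢
    rw [hjoint, hind]
    exact congrArg₂ Measure.prod h1.symm h2.symm
  · change ∀ᵐ a ∂(Q.map Φ), (a i).2 = G.fullγ hd ((a i).1, fun j => (a (i ++ [j])).2)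
    have hms : MeasurableSet {a : TreeWord d → Ω × S |
        (a i).2 = G.fullγ hd ((a i).1, fun j => (a (i ++ [j])).2)} :=
      measurableSet_eq_fun (by fun_prop) (hg.comp (by fun_prop))
    rw [ae_map_iff hΦ.aemeasurable hms]
    have h1 : ∀ᵐ a ∂Q, G.fullγ hd (h (a.1, (a.2 []).1)) = a.1 := by
      have : MeasurePreserving (fun a : TopDown Ω S (Idx d) => (a.1, (a.2 []).1)) Q
          ((μ : Measure S).prod volume) :=
        (MeasurePreserving.id (μ : Measure S)).prod (measurePreserving_fst.comp
          (measurePreserving_eval_infinitePi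
            (fun _ => (volume : Measure unitInterval).prod
              ((r : Measure Ω).prod (μ : Measure S))) []))
      exact this.quasiMeasurePreserving.ae hrec
    filter_upwards [(TopDown.measurePreserving_subtree hh i).quasiMeasurePreserving.ae h1] with a ha
    simp only [Φ, TopDown.subtree_append]
    exact ha.symm

end RandomMap

/-! ### Analysis of a recursive tree process -/

lemma comap_pi_eq_iSup {A ι Ω : Type*} [MeasurableSpace Ω] (W : ι → A → Ω) :
    MeasurableSpace.comap (fun a i => W i a) MeasurableSpace.pi
      = ⨆ i, MeasurableSpace.comap (W i) inferInstance := by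
  simp only [MeasurableSpace.pi, MeasurableSpace.comap_iSup, MeasurableSpace.comap_comp]
  rfl

/-- The filtration generated by a family indexed by the vertices of a tree, revealed level by
level. -/
def levelFiltration {A I Ω : Type*} [mA : MeasurableSpace A] [MeasurableSpace Ω]
    (W : List I → A → Ω) (hW : ∀ i, Measurable (W i)) : Filtration ℕ mA where
  seq t := ⨆ i : {i : List I // i.length < t}, MeasurableSpace.comap (W i.1) inferInstance
  mono' _ t hst := iSup_le fun i => le_iSup_of_le
    (⟨i.1, i.2.trans_le hst⟩ : {i : List I // i.length < t}) le_rfl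
  le' _ := iSup_le fun i => (hW i.1).comap_le

lemma iSup_levelFiltration {A I Ω : Type*} [MeasurableSpace A] [MeasurableSpace Ω]
    (W : List I → A → Ω) (hW : ∀ i, Measurable (W i)) :
    ⨆ t, levelFiltration W hW t = ⨆ i, MeasurableSpace.comap (W i) inferInstance :=
  le_antisymm (iSup_le fun _ => iSup_le fun i => le_iSup_of_le i.1 le_rfl)
    (iSup_le fun i => le_iSup_of_le (i.length + 1)
      (le_iSup_of_le (⟨i, Nat.lt_succ_self _⟩ : {j : List I // j.length < i.length + 1}) le_rfl))

/-- The conditional law of a random variable given an independent one is its law. -/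
lemma condDistrib_ae_eq_const_of_indepFun {A β S : Type*} [MeasurableSpace A] [MeasurableSpace β]
    [MeasurableSpace S] [StandardBorelSpace S] [Nonempty S] {P : Measure A} [IsProbabilityMeasure P]
    {Y : A → S} {Z : A → β} (hY : Measurable Y) (hZ : Measurable Z) (h : IndepFun Z Y P) :
    condDistrib Y Z P =ᵐ[P.map Z] Kernel.const β (P.map Y) := by
  have : IsProbabilityMeasure (P.map Y) := Measure.isProbabilityMeasure_map hY.aemeasurable
  refine condDistrib_ae_eq_of_measure_eq_compProd Z hY.aemeasurable ?_
  rw [Measure.compProd_const]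
  exact (indepFun_iff_map_prod_eq_prod_map_map hZ.aemeasurable hY.aemeasurable).1 h

namespace RandomMap

namespace IsRTP

variable {Ω : Type v} {S : Type u} [MeasurableSpace Ω] [MeasurableSpace S]
  {G : RandomMap Ω S} {r : ProbabilityMeasure Ω} {d : ℕ∞} {hd : ∀ ω, G.κ ω ≤ d}
  {μ : ProbabilityMeasure S} {A : Type w} [MeasurableSpace A] {P : Measure A}
  {W : TreeWord d → A → Ω} {X : TreeWord d → A → S}

lemma ae_eq_treeEval (hR : G.IsRTP r hd μ P W X) (t : ℕ) (w : TreeWord d) :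
    ∀ᵐ a ∂P, X w a
      = treeEval (G.fullγ hd) t (fun v => W (w ++ v) a) (fun v => X (w ++ v) a) := by
  induction t generalizing w with
  | zero => simp [treeEval]
  | succ t ih =>
    filter_upwards [hR.recursion w, ae_all_iff.2 fun j => ih (w ++ [j])] with a h1 h2
    change X w a = G.fullγ hd (W w a, fun j => X (w ++ [j]) a) at h1
    rw [h1]
    simp only [treeEval, List.append_nil, h2, List.append_assoc, List.singleton_append]

variable [IsProbabilityMeasure P]

lemma map_W (hR : G.IsRTP r hd μ P W X) :
    P.map (fun a i => W i a) = Measure.infinitePi fun _ => (r : Measure Ω) := by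
  rw [(iIndepFun_iff_map_fun_eq_infinitePi_map hR.measurable_W).1 hR.iIndepFun_W]
  simp_rw [hR.law_W]

/-- The conditional probability that the root value lies in `E`, given the randomness up to depth
`t`. -/
lemma condExp_levelFiltration [StandardBorelSpace S] (hR : G.IsRTP r hd μ P W X) {t : ℕ}
    (ht : 1 ≤ t) {E : Set S} (hE : MeasurableSet E) :
    P⟦X [] ⁻¹' E | levelFiltration W hR.measurable_W t⟧
      =ᵐ[P] fun a => G.rootProb hd μ t E (fun i => W i a) := by
  classical
  obtain ⟨ω₀⟩ : Nonempty Ω := r.nonempty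
  have hS : Nonempty S := μ.nonempty
  obtain ⟨s₀⟩ := id hS
  have hWm := hR.measurable_W
  have hXm := hR.measurable_X
  let Θ : A → {i : TreeWord d // i.length < t} → Ω := fun a i => W i.1 a
  let Y : A → {i : TreeWord d // i.length = t} → S := fun a i => X i.1 a
  have hΘ : Measurable Θ := measurable_pi_lambda _ fun i => hWm i.1
  have hY : Measurable Y := measurable_pi_lambda _ fun i => hXm i.1
  -- labels at the irrelevant vertices are filled in arbitrarily
  let e₁ : ({i : TreeWord d // i.length < t} → Ω) → TreeWord d → Ω :=
    fun θ w => if h : w.length < t then θ ⟨w, h⟩ else ω₀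
  let e₂ : ({i : TreeWord d // i.length = t} → S) → TreeWord d → S :=
    fun y w => if h : w.length = t then y ⟨w, h⟩ else s₀
  have he₁ : Measurable e₁ := measurable_pi_lambda _ fun w => by
    simp only [e₁]; split_ifs <;> fun_prop
  have he₂ : Measurable e₂ := measurable_pi_lambda _ fun w => by
    simp only [e₂]; split_ifs <;> fun_prop
  let B : Set (({i : TreeWord d // i.length < t} → Ω) × ({i : TreeWord d // i.length = t} → S)) :=
    {p | treeEval (G.fullγ hd) t (e₁ p.1) (e₂ p.2) ∈ E}
  have hB : MeasurableSet B :=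
    ((measurable_treeEval (G.measurable_fullγ hd) t).comp
      ((he₁.comp measurable_fst).prodMk (he₂.comp measurable_snd))) hE
  let f : (({i : TreeWord d // i.length < t} → Ω) × ({i : TreeWord d // i.length = t} → S)) → ℝ :=
    B.indicator fun _ => 1
  have hf : StronglyMeasurable f := stronglyMeasurable_const.indicator hB
  have hXf : (X [] ⁻¹' E).indicator (fun _ => (1 : ℝ)) =ᵐ[P] fun a => f (Θ a, Y a) := by
    filter_upwards [hR.ae_eq_treeEval t []] with a ha
    have : treeEval (G.fullγ hd) t (e₁ (Θ a)) (e₂ (Y a)) = X [] a := by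
      rw [ha]
      refine treeEval_congr _ t (fun w hw => ?_) (fun w hw => ?_)
      · simp [e₁, Θ, hw]
      · simp [e₂, Y, hw]
    simp [f, B, Set.indicator, this]
  have hind : IndepFun Θ Y P := (hR.indepFun_X_W t ht).symm
  have hconst := ae_of_ae_map hΘ.aemeasurable (condDistrib_ae_eq_const_of_indepFun hY hΘ hind)
  have hlawY : P.map Y = (Measure.infinitePi fun _ : TreeWord d => (μ : Measure S)).map
      (fun x (i : {i : TreeWord d // i.length = t}) => x i.1) := by
    rw [Measure.map_infinitePi_infinitePi_of_inj (P := fun _ : TreeWord d => (μ : Measure S))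
      Subtype.val_injective]
    refine (iIndepFun.map_fun_eq_infinitePi_map
      (X := fun (i : {i : TreeWord d // i.length = t}) => X i.1)
      (fun i => hXm i.1) (hR.iIndepFun_X t ht)).trans ?_
    congr 1
    ext1 i
    exact hR.law_X t ht i.1 i.2
  have hF : levelFiltration W hWm t = MeasurableSpace.comap Θ MeasurableSpace.pi :=
    (comap_pi_eq_iSup fun (i : {i : TreeWord d // i.length < t}) => W i.1).symm
  rw [hF]
  refine (condExp_congr_ae hXf).trans ?_
  refine (condExp_prod_ae_eq_integral_condDistrib hΘ hY.aemeasurable hf ?_).trans ?_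
  · refine Integrable.of_bound (C := 1)
      (hf.measurable.comp (hΘ.prodMk hY)).aestronglyMeasurable (Eventually.of_forall fun a => ?_)
    by_cases h : (Θ a, Y a) ∈ B <;> simp [f, h]
  · filter_upwards [hconst] with a ha
    have hsec : MeasurableSet (Prod.mk (Θ a) ⁻¹' B) := measurable_prodMk_left hB
    have h1 : ∀ y, f (Θ a, y) = (Prod.mk (Θ a) ⁻¹' B).indicator (fun _ => (1 : ℝ)) y := fun y => rfl
    rw [ha, Kernel.const_apply]
    simp_rw [h1]
    rw [integral_indicator_const _ hsec, smul_eq_mul, mul_one, hlawY,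
      map_measureReal_apply (by fun_prop) hsec, rootProb]
    congr 1
    ext x
    have h2 : treeEval (G.fullγ hd) t (e₁ (Θ a)) (e₂ fun i => x i.1)
        = treeEval (G.fullγ hd) t (fun i => W i a) x := by
      refine treeEval_congr _ t (fun w hw => ?_) (fun w hw => ?_)
      · simp [e₁, Θ, hw]
      · simp [e₂, hw]
    simp [B, h2]

lemma integral_comp_W (hR : G.IsRTP r hd μ P W X)
    {f : (TreeWord d → Ω) → ℝ} (hf : Measurable f) :
    ∫ a, f (fun i => W i a) ∂P = ∫ θ, f θ ∂(Measure.infinitePi fun _ => (r : Measure Ω)) := by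
  rw [← hR.map_W, integral_map (measurable_pi_lambda _ hR.measurable_W).aemeasurable
    hf.aestronglyMeasurable]

lemma measureReal_root [StandardBorelSpace S] (hR : G.IsRTP r hd μ P W X) (hμ : G.T r μ = μ)
    {E : Set S} (hE : MeasurableSet E) : P.real (X [] ⁻¹' E) = (μ : Measure S).real E := by
  rw [← G.integral_rootProb r hd hμ 1 hE, ← hR.integral_comp_W (G.measurable_rootProb hd μ 1 hE),
    ← integral_congr_ae (hR.condExp_levelFiltration le_rfl hE),
    integral_condExp ((levelFiltration W hR.measurable_W).le 1),
    integral_indicator_const _ (hR.measurable_X [] hE), smul_eq_mul, mul_one]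

/-- By martingale convergence, `(T^{(2)})^t(μ ⊗ μ)` converges on rectangles to the law of two copies
of the root value that are conditionally independent given the randomness in the whole tree. -/
lemma tendsto_iterate_T2 [StandardBorelSpace S] (hR : G.IsRTP r hd μ P W X) {E F : Set S}
    (hE : MeasurableSet E) (hF : MeasurableSet F) :
    Tendsto (fun t => (((G.Tn r 2)^[t] (indepPair μ) : ProbabilityMeasure (Idx 2 → S)) :
        Measure (Idx 2 → S)).real {y | y fstIdx ∈ E ∧ y sndIdx ∈ F}) atTop
      (𝓝 (∫ a, (P⟦X [] ⁻¹' E | ⨆ i, MeasurableSpace.comap (W i) inferInstance⟧) a *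
        (P⟦X [] ⁻¹' F | ⨆ i, MeasurableSpace.comap (W i) inferInstance⟧) a ∂P)) := by
  have hlim : ∀ {E : Set S}, MeasurableSet E → ∀ᵐ a ∂P,
      Tendsto (fun t => G.rootProb hd μ t E (fun i => W i a)) atTop
        (𝓝 ((P⟦X [] ⁻¹' E | ⨆ i, MeasurableSpace.comap (W i) inferInstance⟧) a)) := by
    intro E hE
    have h1 := tendsto_ae_condExp (ℱ := levelFiltration W hR.measurable_W) (μ := P)
      ((X [] ⁻¹' E).indicator fun _ => (1 : ℝ))
    rw [iSup_levelFiltration] at h1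
    have h2 : ∀ᵐ a ∂P, ∀ t : ℕ, 1 ≤ t → (P⟦X [] ⁻¹' E | levelFiltration W hR.measurable_W t⟧) a
        = G.rootProb hd μ t E (fun i => W i a) :=
      ae_all_iff.2 fun t => by
        by_cases ht : 1 ≤ t
        · filter_upwards [hR.condExp_levelFiltration ht hE] with a ha _
          exact ha
        · exact Eventually.of_forall fun a h => absurd h ht
    filter_upwards [h1, h2] with a h1 h2
    refine h1.congr' ?_
    filter_upwards [eventually_ge_atTop 1] with t ht
    exact h2 t ht
  simp_rw [G.iterate_T2_indepPair r hd μ _ hE hF]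
  have hint : ∀ t, ∫ θ, G.rootProb hd μ t E θ * G.rootProb hd μ t F θ
      ∂(Measure.infinitePi fun _ => (r : Measure Ω))
      = ∫ a, G.rootProb hd μ t E (fun i => W i a) * G.rootProb hd μ t F (fun i => W i a) ∂P :=
    fun t => (hR.integral_comp_W ((G.measurable_rootProb hd μ t hE).mul
      (G.measurable_rootProb hd μ t hF))).symm
  simp_rw [hint]
  refine tendsto_integral_of_dominated_convergence (fun _ => 1) (fun t => ?_)
    (integrable_const _) (fun t => Eventually.of_forall fun a => ?_) ?_
  · exact (((G.measurable_rootProb hd μ t hE).mul (G.measurable_rootProb hd μ t hF)).comp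
      (measurable_pi_lambda _ hR.measurable_W)).aestronglyMeasurable
  · have h1 := G.rootProb_nonneg hd μ t E (fun i => W i a)
    have h2 := G.rootProb_nonneg hd μ t F (fun i => W i a)
    rw [Real.norm_of_nonneg (mul_nonneg h1 h2)]
    exact mul_le_one₀ (G.rootProb_le_one hd μ t E _) h2 (G.rootProb_le_one hd μ t F _)
  · filter_upwards [hlim hE, hlim hF] with a h1 h2
    exact h1.mul h2

end IsRTP

end RandomMap

/-! ### Endogeny and bivariate uniqueness -/

namespace RandomMap

variable {Ω : Type v} {S : Type u} [MeasurableSpace Ω] [MeasurableSpace S]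
  {G : RandomMap Ω S} {r : ProbabilityMeasure Ω} {d : ℕ∞} {hd : ∀ ω, G.κ ω ≤ d}
  {μ : ProbabilityMeasure S} {A : Type w} [MeasurableSpace A] {P : Measure A}
  {W : TreeWord d → A → Ω} {X : TreeWord d → A → S}

lemma diagLaw_mem_symLawsWithMarginal (n : ℕ∞) (μ : ProbabilityMeasure S) :
    diagLaw n μ ∈ symLawsWithMarginal n μ := by
  have h : (diagLaw n μ : Measure (Idx n → S)) = (μ : Measure S).map (fun x _ => x) := rfl
  refine ⟨fun m => ?_, fun σ => ?_⟩
  · rw [h, Measure.map_map (by fun_prop) (by fun_prop)]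
    exact Measure.map_id
  · have hσ : Measurable fun x : Idx n → S => x ∘ σ :=
      measurable_pi_lambda _ fun i => measurable_pi_apply (σ i)
    rw [h, Measure.map_map hσ (by fun_prop)]
    rfl

/-- For an endogenous process, the conditional probabilities that the root value lies in a given
set, given the randomness up to a finite depth, become asymptotically trivial. -/
lemma IsRTP.tendsto_diag_of_rootMeasurable [IsProbabilityMeasure P] [StandardBorelSpace S]
    (hR : G.IsRTP r hd μ P W X) (hμ : G.T r μ = μ) (hY : RootMeasurable P W X) {E : Set S}
    (hE : MeasurableSet E) :
    Tendsto (fun t => ∫ θ, G.rootProb hd μ t E θ * G.rootProb hd μ t E θ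
      ∂(Measure.infinitePi fun _ => (r : Measure Ω))) atTop (𝓝 ((μ : Measure S).real E)) := by
  obtain ⟨Y, hYm, hXY⟩ := hY
  have h := hR.tendsto_iterate_T2 hE hE
  simp_rw [G.iterate_T2_indepPair r hd μ _ hE hE] at h
  convert h using 2
  have hle : ⨆ i, MeasurableSpace.comap (W i) inferInstance ≤ (inferInstance : MeasurableSpace A) :=
    iSup_le fun i => (hR.measurable_W i).comap_le
  have h1 : (X [] ⁻¹' E).indicator (fun _ => (1 : ℝ)) =ᵐ[P] (Y ⁻¹' E).indicator fun _ => 1 := by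
    filter_upwards [hXY] with a ha
    have hiff : a ∈ X [] ⁻¹' E ↔ a ∈ Y ⁻¹' E := by rw [Set.mem_preimage, Set.mem_preimage, ha]
    by_cases hy : a ∈ Y ⁻¹' E
    · rw [Set.indicator_of_mem hy, Set.indicator_of_mem (hiff.2 hy)]
    · rw [Set.indicator_of_notMem hy, Set.indicator_of_notMem (mt hiff.1 hy)]
  have h2 : P⟦X [] ⁻¹' E | ⨆ i, MeasurableSpace.comap (W i) inferInstance⟧
      =ᵐ[P] (X [] ⁻¹' E).indicator fun _ => 1 := by
    refine (condExp_congr_ae h1).trans ?_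
    rw [condExp_of_stronglyMeasurable hle]
    · exact h1.symm
    · exact stronglyMeasurable_const.indicator (hYm hE)
    · exact (integrable_const _).indicator (hle _ (hYm hE))
  have h3 : ∫ a, (P⟦X [] ⁻¹' E | ⨆ i, MeasurableSpace.comap (W i) inferInstance⟧) a *
        (P⟦X [] ⁻¹' E | ⨆ i, MeasurableSpace.comap (W i) inferInstance⟧) a ∂P
      = ∫ a, (X [] ⁻¹' E).indicator (fun _ => (1 : ℝ)) a ∂P := by
    refine integral_congr_ae ?_
    filter_upwards [h2] with a ha
    rw [ha]
    by_cases h : a ∈ X [] ⁻¹' E <;> simp [h]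
  rw [h3, integral_indicator_const _ (hR.measurable_X [] hE), smul_eq_mul, mul_one,
    hR.measureReal_root hμ hE]

lemma measurable_pairFun :
    Measurable (fun (p : S × S) (i : Idx 2) => if i = fstIdx then p.1 else p.2) :=
  measurable_pi_lambda _ fun i => by split_ifs <;> fun_prop

/-- The law of two random variables with values in `S` that, given `w` with law `ρ`, are
independent with conditional law `K w`. -/
noncomputable def condPairLaw {B : Type*} [MeasurableSpace B] (ρ : Measure B)
    [IsProbabilityMeasure ρ] (K : Kernel B S) [IsMarkovKernel K] :
    ProbabilityMeasure (Idx 2 → S) :=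
  ⟨((K ×ₖ K) ∘ₘ ρ).map (fun p i => if i = fstIdx then p.1 else p.2),
    Measure.isProbabilityMeasure_map measurable_pairFun.aemeasurable⟩

lemma condPairLaw_rect {B : Type*} [MeasurableSpace B] (ρ : Measure B)
    [IsProbabilityMeasure ρ] (K : Kernel B S) [IsMarkovKernel K] {E F : Set S}
    (hE : MeasurableSet E) (hF : MeasurableSet F) :
    (condPairLaw ρ K : Measure (Idx 2 → S)).real {y | y fstIdx ∈ E ∧ y sndIdx ∈ F}
      = ∫ w, (K w).real E * (K w).real F ∂ρ := by
  have hset := measurableSet_rect hE hF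
  have hpre : (fun (p : S × S) (i : Idx 2) => if i = fstIdx then p.1 else p.2) ⁻¹'
      {y | y fstIdx ∈ E ∧ y sndIdx ∈ F} = E ×ˢ F := by
    ext p
    simp [fstIdx_ne_sndIdx.symm]
  change (((K ×ₖ K) ∘ₘ ρ).map _).real _ = _
  rw [map_measureReal_apply measurable_pairFun hset, hpre, measureReal_def,
    Measure.bind_apply (hE.prod hF) (Kernel.aemeasurable _), ← integral_toReal
      ((Kernel.measurable_coe _ (hE.prod hF)).aemeasurable) (by simp)]
  refine integral_congr_ae (Eventually.of_forall fun w => ?_)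
  simp only [Kernel.prod_apply, Measure.prod_prod, ENNReal.toReal_mul, measureReal_def]

/-- If two conditionally independent copies with conditional law `K w` agree, then `K w` is a point
mass. -/
lemma ae_eq_of_condPairLaw_eq_diagLaw [StandardBorelSpace S] {B : Type*} [MeasurableSpace B]
    (ρ : Measure B) [IsProbabilityMeasure ρ] (K : Kernel B S) [IsMarkovKernel K]
    (h : condPairLaw ρ K = diagLaw 2 μ) :
    ∀ᵐ w ∂ρ, ∀ᵐ x ∂(K w), ∀ᵐ y ∂(K w), x = y := by
  have hset : MeasurableSet {y : Idx 2 → S | y fstIdx = y sndIdx} :=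
    measurableSet_eq_fun (measurable_pi_apply _) (measurable_pi_apply _)
  have h1 : ∀ᵐ y ∂(diagLaw 2 μ : Measure (Idx 2 → S)), y fstIdx = y sndIdx := by
    change ∀ᵐ y ∂((μ : Measure S).map fun x _ => x), y fstIdx = y sndIdx
    rw [ae_map_iff (by fun_prop) hset]
    exact Eventually.of_forall fun _ => rfl
  rw [← h] at h1
  have h2 := ae_of_ae_map measurable_pairFun.aemeasurable h1
  have h3 := Measure.ae_ae_of_ae_comp h2
  filter_upwards [h3] with w hw
  rw [Kernel.prod_apply] at hw
  have h4 := Measure.ae_ae_of_ae_prod hw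
  simpa [fstIdx_ne_sndIdx.symm] using h4

/-- If the diagonal law is the only symmetric fixed point of `T^{(2)}` with marginals `μ`, then the
root value is determined by the randomness: the law of two copies of the root value that are
conditionally independent given the randomness is such a fixed point. -/
lemma IsRTP.rootMeasurable [IsProbabilityMeasure P] [StandardBorelSpace S]
    (hR : G.IsRTP r hd μ P W X) (hμ : G.T r μ = μ)
    (huniq : ∀ ν ∈ symLawsWithMarginal 2 μ, G.Tn r 2 ν = ν → ν = diagLaw 2 μ) :
    RootMeasurable P W X := by
  have hS : Nonempty S := μ.nonempty
  have hWm : Measurable fun a i => W i a := measurable_pi_lambda _ hR.measurable_W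
  have hXm := hR.measurable_X []
  let ρ := P.map fun a i => W i a
  have hρ : IsProbabilityMeasure ρ := Measure.isProbabilityMeasure_map hWm.aemeasurable
  let K := condDistrib (X []) (fun a i => W i a) P
  let ν := condPairLaw ρ K
  let νt : ℕ → ProbabilityMeasure (Idx 2 → S) := fun t => (G.Tn r 2)^[t] (indepPair μ)
  have hνt : ∀ t, νt t ∈ lawsWithMarginal 2 μ := G.iterate_Tn_mem r hμ fun m =>
    Measure.infinitePi_map_eval (fun _ => (μ : Measure S)) m
  have hlim : ∀ E F : Set S, MeasurableSet E → MeasurableSet F → Tendsto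
      (fun t => (νt t : Measure (Idx 2 → S)).real {y | y fstIdx ∈ E ∧ y sndIdx ∈ F}) atTop
      (𝓝 ((ν : Measure (Idx 2 → S)).real {y | y fstIdx ∈ E ∧ y sndIdx ∈ F})) := by
    intro E F hE hF
    convert hR.tendsto_iterate_T2 hE hF using 2
    have hmeas : Measurable fun w => (K w).real E * (K w).real F :=
      (Kernel.measurable_coe K hE).ennreal_toReal.mul (Kernel.measurable_coe K hF).ennreal_toReal
    rw [condPairLaw_rect _ _ hE hF, integral_map hWm.aemeasurable hmeas.aestronglyMeasurable]
    have h1 := condDistrib_ae_eq_condExp (μ := P) hWm hXm hE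
    have h2 := condDistrib_ae_eq_condExp (μ := P) hWm hXm hF
    rw [comap_pi_eq_iSup] at h1 h2
    refine integral_congr_ae ?_
    filter_upwards [h1, h2] with a h1 h2
    rw [← h1, ← h2]
  have hsymm : ∀ E F : Set S, MeasurableSet E → MeasurableSet F →
      (ν : Measure (Idx 2 → S)).real {y | y fstIdx ∈ E ∧ y sndIdx ∈ F}
        = (ν : Measure (Idx 2 → S)).real {y | y fstIdx ∈ F ∧ y sndIdx ∈ E} := by
    intro E F hE hF
    rw [condPairLaw_rect _ _ hE hF, condPairLaw_rect _ _ hF hE]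
    simp_rw [mul_comm]
  have hfst : ∀ E : Set S, MeasurableSet E →
      (ν : Measure (Idx 2 → S)).real {y | y fstIdx ∈ E} = (μ : Measure S).real E := by
    intro E hE
    have h1 := hlim E Set.univ hE .univ
    simp only [Set.mem_univ, and_true] at h1
    refine tendsto_nhds_unique h1 ?_
    have h2 : ∀ t, (νt t : Measure (Idx 2 → S)).real {y | y fstIdx ∈ E}
        = (μ : Measure S).real E := by
      intro t
      rw [← hνt t fstIdx, map_measureReal_apply (by fun_prop) hE]
      rfl
    simp_rw [h2]
    exact tendsto_const_nhds
  have hsnd : ∀ E : Set S, MeasurableSet E →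
      (ν : Measure (Idx 2 → S)).real {y | y sndIdx ∈ E} = (μ : Measure S).real E := by
    intro E hE
    have h1 := hsymm Set.univ E .univ hE
    simp only [Set.mem_univ, and_true, true_and] at h1
    rw [h1, hfst E hE]
  have hmarg : ν ∈ lawsWithMarginal 2 μ := by
    intro m
    have : IsProbabilityMeasure ((ν : Measure (Idx 2 → S)).map fun x => x m) :=
      Measure.isProbabilityMeasure_map (measurable_pi_apply m).aemeasurable
    ext E hE
    refine (measureReal_eq_measureReal_iff).1 ?_
    rw [map_measureReal_apply (by fun_prop) hE]
    rcases idx_two_cases m with rfl | rfl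
    · exact hfst E hE
    · exact hsnd E hE
  have hmem : ν ∈ symLawsWithMarginal 2 μ := by
    refine ⟨hmarg, fun σ => ?_⟩
    have hσ : Measurable fun x : Idx 2 → S => x ∘ σ :=
      measurable_pi_lambda _ fun i => measurable_pi_apply (σ i)
    have : IsProbabilityMeasure ((ν : Measure (Idx 2 → S)).map fun x => x ∘ σ) :=
      Measure.isProbabilityMeasure_map hσ.aemeasurable
    refine ext_of_rect fun E F hE hF => ?_
    rw [map_measureReal_apply hσ (measurableSet_rect hE hF)]
    have hne : σ fstIdx ≠ σ sndIdx := σ.injective.ne fstIdx_ne_sndIdx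
    rcases idx_two_cases (σ fstIdx) with h1 | h1 <;> rcases idx_two_cases (σ sndIdx) with h2 | h2
    · exact absurd (h1.trans h2.symm) hne
    · simp [Set.preimage, h1, h2]
    · rw [hsymm E F hE hF]
      simp only [Set.preimage, Set.mem_ofPred_eq, Function.comp, h1, h2, and_comm]
    · exact absurd (h1.trans h2.symm) hne
  have hfix : G.Tn r 2 ν = ν := by
    apply Subtype.ext
    change (G.Tn r 2 ν : Measure (Idx 2 → S)) = (ν : Measure (Idx 2 → S))
    refine ext_of_rect fun E F hE hF => ?_
    have h1 := G.tendsto_T2_rect r hνt hmarg hlim hE hF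
    have h2 := (tendsto_add_atTop_iff_nat 1).2 (hlim E F hE hF)
    simp only [νt, Function.iterate_succ_apply'] at h2
    exact tendsto_nhds_unique h1 h2
  have hdirac := ae_eq_of_condPairLaw_eq_diagLaw ρ K (huniq ν hmem hfix)
  -- the root value is recovered from the conditional mean of its image under an embedding into `ℝ`
  let e := embeddingReal S
  have he : MeasurableEmbedding e := measurableEmbedding_embeddingReal S
  let c : (TreeWord d → Ω) → ℝ := fun w => ∫ y, e y ∂(K w)
  have hc : Measurable c :=
    (he.measurable.stronglyMeasurable.integral_kernel).measurable
  have hc_eq : ∀ᵐ w ∂ρ, ∀ᵐ x ∂(K w), e x = c w := by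
    filter_upwards [hdirac] with w hw
    filter_upwards [hw] with x hx
    have : ∫ y, e y ∂(K w) = ∫ _, e x ∂(K w) :=
      integral_congr_ae (hx.mono fun y hy => by rw [hy])
    simp [c, this]
  have hjoint : ∀ᵐ p ∂(P.map fun a => ((fun i => W i a), X [] a)), e p.2 = c p.1 := by
    rw [← compProd_map_condDistrib hXm.aemeasurable]
    exact Measure.ae_compProd_of_ae_ae (measurableSet_eq_fun (he.measurable.comp measurable_snd)
      (hc.comp measurable_fst)) hc_eq
  have hae := ae_of_ae_map (hWm.prodMk hXm).aemeasurable hjoint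
  refine ⟨fun a => he.invFun (c fun i => W i a), ?_, ?_⟩
  · rw [← comap_pi_eq_iSup]
    exact (he.measurable_invFun.comp hc).comp (comap_measurable _)
  · filter_upwards [hae] with a ha
    rw [← ha]
    exact (he.leftInverse_invFun _).symm

end RandomMap

theorem mainTheorem2 {Ω : Type v} {S : Type u}
    [TopologicalSpace Ω] [PolishSpace Ω] [MeasurableSpace Ω] [BorelSpace Ω]
    [TopologicalSpace S] [PolishSpace S] [MeasurableSpace S] [BorelSpace S]
    (G : RandomMap Ω S) (r : ProbabilityMeasure Ω)
    (d : ℕ∞) (one_le_d : 1 ≤ d) (hd : ∀ ω, G.κ ω ≤ d)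
    (μ : ProbabilityMeasure S) (hμ : G.T r μ = μ) :
    List.TFAE [
      G.Endogenous r hd μ,
      diagLaw 2 μ ∈ symLawsWithMarginal 2 μ ∧ G.Tn r 2 (diagLaw 2 μ) = diagLaw 2 μ ∧
        ∀ ν ∈ symLawsWithMarginal 2 μ, G.Tn r 2 ν = ν → ν = diagLaw 2 μ,
      ∀ n : ℕ∞, 1 ≤ n → ∀ ν ∈ lawsWithMarginal n μ,
        Tendsto (fun t : ℕ => (G.Tn r n)^[t] ν) atTop (𝓝 (diagLaw n μ))] := by
  tfae_have 1 → 3 := by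
    rintro ⟨⟨P, hR⟩, hendo⟩ n hn ν hν
    have hn' : ((0 : ℕ) : ℕ∞) < n := by
      rw [Nat.cast_zero]; exact lt_of_lt_of_le zero_lt_one hn
    refine tendsto_diagLaw ⟨0, hn'⟩ μ _ (fun t => G.iterate_Tn_mem r hμ hν t ⟨0, hn'⟩)
      fun j E hE => ?_
    have h1 := hR.tendsto_diag_of_rootMeasurable hμ (hendo P hR) hE
    have h2 : Tendsto (fun t => 2 * ((μ : Measure S).real E -
        ∫ θ, G.rootProb hd μ t E θ * G.rootProb hd μ t E θ
          ∂(Measure.infinitePi fun _ => (r : Measure Ω)))) atTop (𝓝 0) := by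
      simpa using ((tendsto_const_nhds (x := (μ : Measure S).real E)).sub h1).const_mul 2
    have h3 := squeeze_zero (fun t => measureReal_nonneg)
      (fun t => G.iterate_Tn_separate_le r hd hμ hν t ⟨0, hn'⟩ j hE) h2
    exact (ENNReal.tendsto_toReal_zero_iff fun t => measure_ne_top _ _).1 h3
  tfae_have 3 → 2 := by
    intro h
    refine ⟨RandomMap.diagLaw_mem_symLawsWithMarginal 2 μ, by rw [G.Tn_diagLaw, hμ],
      fun ν hν hfix => ?_⟩
    have h1 := h 2 (by norm_num) ν hν.1
    simp only [Function.iterate_fixed hfix] at h1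
    exact tendsto_nhds_unique tendsto_const_nhds h1
  tfae_have 2 → 1 := by
    rintro ⟨-, -, huniq⟩
    exact ⟨G.exists_isRTP r hd hμ, fun P hR => hR.rootMeasurable hμ huniq⟩
  tfae_finish
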